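/- All graphs are finite and directed; an undirected edge $(a,b)$ stands for the two directed edges $(a,b)$ and $(b,a)$. Let $G$ be a graph with $k$ distinct vertices labelled $i_1,\dots,i_k$ (the incoming vertices) and $k$ distinct vertices labelled $o_1,\dots,o_k$ (the outgoing vertices); a vertex may be both incoming and outgoing. $G$ with these labels is a *$k$-in-out graph* if 1. (paired vertices condition) for all $j,m\in\{1,\dots,k\}$, there is a Hamiltonian path of $G$ from $i_j$ to $o_m$ if and only if $j=m$; and 2. (single visit condition) there is no family of two or more pairwise disjoint paths of $G$, each starting at an incoming vertex and finishing at an outgoing vertex (a single vertex that is both counts as a path), that together visit all vertices of $G$. For $k\ge 4$ let $\mathcal S_k$ be the directed graph on the vertices $1,2,\dots,2k-1$ with the following edges. If $k$ is even: - undirected edges $(4i-2,4i-1)$, $(4i-1,4i)$, $(4i,4i+1)$ for $i=1,\dots,\frac{k-2}{2}$; - directed edges $(4i-2,4i+5)$, $(4i+1,4i+2)$ for $i=1,\dots,\frac{k-4}{2}$; - directed edges $(1,2)$, $(2k-6,2k-1)$, $(2k-3,2k-2)$, $(2k-2,1)$, $(2k-2,5)$, $(2k-1,2k-2)$. If $k$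 is odd: - undirected edges $(4i-2,4i-1)$, $(4i-1,4i)$, $(4i,4i+1)$ for $i=1,\dots,\frac{k-1}{2}$; - directed edges $(4i-2,4i+5)$, $(4i+1,4i+2)$ for $i=1,\dots,\frac{k-3}{2}$; - directed edges $(1,2)$, $(2k-4,1)$, $(2k-2,5)$. The incoming vertices are $i_j=2j-1$ for $j=1,\dots,k$. The outgoing vertices are $o_{2j}=4j+3$ and $o_{2j+1}=4j-3$ for $j=1,\dots,\lfloor\frac{k-3}{2}\rfloor$, together with $o_1=3$, $o_{k-2}=2k-1$, $o_{k-1}=2k-7$, $o_k=2k-3$ if $k$ is even, and $o_1=2k-1$, $o_{k-1}=3$, $o_k=2k-5$ if $k$ is odd. **Theorem.** Let $k\ge 4$. (a) $\mathcal S_k$ with these labels is a $k$-in-out graph. It has $2k-1$ vertices, and every $k$-in-out graph has at least $2k-1$ vertices, so its order is minimal. (b) $\mathcal S_k$ is bipartite with parts the odd vertices ($k$ of them) and the even vertices ($k-1$ of them), and all incoming and outgoing vertices are odd. Moreover, whenever the vertex set of a graph $G$ with incoming and outgoing vertices can be partitioned into $V_1,V_2$ such that every edge has one end in each part, $|V_1|=|V_2|+1$,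 and all incoming and outgoing vertices lie in $V_1$, then $G$ satisfies the single visit condition. (c) $\mathcal S_k$ has $4k-4$ directed edges if $k$ is even and $4k-3$ directed edges if $k$ is odd. Every $k$-in-out graph with $2k-1$ vertices has at least $4k-4$ directed edges; so for even $k$ the number of edges of $\mathcal S_k$ is minimal among $k$-in-out graphs with $2k-1$ vertices. -/

import Mathlib

namespace InOut

/-- `p` lists the vertices, in order, of a simple directed path of `G` from `u` to `v`.
The one-vertex path (where `u = v`) is allowed. -/
def IsPath {V : Type*} (G : Digraph V) (u v : V) (p : List V) : Prop :=
  p.head? = some u ∧ p.getLast? = some v ∧ p.Nodup ∧ p.IsChain G.Adj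

/-- `G` has a Hamiltonian path starting at `u` and finishing at `v`. -/
def HasHamiltonianPath {V : Type*} (G : Digraph V) (u v : V) : Prop :=
  ∃ p : List V, IsPath G u v p ∧ ∀ w : V, w ∈ p

/-- For all `j`, `m`, there is a Hamiltonian path from the incoming vertex `i_j` to the outgoing
vertex `o_m` if and only if `j = m`. -/
def PairedVertices {V : Type*} (G : Digraph V) {k : ℕ} (inc out : Fin k → V) : Prop :=
  ∀ j m : Fin k, HasHamiltonianPath G (inc j) (out m) ↔ j = m

/-- There is no family of more than one pairwise disjoint paths, each starting at an incoming vertex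
and finishing at an outgoing vertex, that together visit all vertices. -/
def SingleVisit {V : Type*} (G : Digraph V) {k : ℕ} (inc out : Fin k → V) : Prop :=
  ¬ ∃ (n : ℕ) (p : Fin n → List V), 2 ≤ n ∧
      (∀ a, ∃ j m : Fin k, IsPath G (inc j) (out m) (p a)) ∧
      (∀ a b, a ≠ b → (p a).Disjoint (p b)) ∧
      (∀ w : V, ∃ a, w ∈ p a)

/-- `G`, with incoming vertices `inc` and outgoing vertices `out`, is a `k`-in-out graph. The `k`
incoming vertices are distinct, and so are the `k` outgoing ones, but an incoming vertex may also be
outgoing. -/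
structure IsInOutGraph {V : Type*} (G : Digraph V) {k : ℕ} (inc out : Fin k → V) : Prop where
  inc_injective : Function.Injective inc
  out_injective : Function.Injective out
  paired : PairedVertices G inc out
  single : SingleVisit G inc out

/-- The number of directed edges (an undirected edge counts as two). -/
noncomputable def edgeCount {V : Type*} (G : Digraph V) : ℕ :=
  {e : V × V | G.Adj e.1 e.2}.ncard

/-- `A` and its complement form a bipartition of `G` (every edge has one end in each part),
the part `A` has exactly one more vertex than the other, and it contains all incoming and all
outgoing vertices. -/
def IsInOutBipartition {V : Type*} (G : Digraph V) {k : ℕ} (inc out : Fin k → V)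
    (A : Set V) : Prop :=
  (∀ u v, G.Adj u v → (u ∈ A ↔ v ∉ A)) ∧ A.ncard = Aᶜ.ncard + 1 ∧
    (∀ j, inc j ∈ A) ∧ (∀ j, out j ∈ A)

/-- `(u, v)` is the directed edge `(a, b)`. -/
def Dir (a b u v : ℕ) : Prop := u = a ∧ v = b

/-- `(u, v)` is one of the two directions of the undirected edge `(a, b)`. -/
def Und (a b u v : ℕ) : Prop := Dir a b u v ∨ Dir b a u v

/-- The edges of `S_k` for even `k ≥ 4`. -/
def evenAdj (k u v : ℕ) : Prop :=
  (∃ i ∈ Finset.Icc 1 ((k - 2) / 2),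
    Und (4 * i - 2) (4 * i - 1) u v ∨ Und (4 * i - 1) (4 * i) u v ∨
      Und (4 * i) (4 * i + 1) u v) ∨
  (∃ i ∈ Finset.Icc 1 ((k - 4) / 2),
    Dir (4 * i - 2) (4 * i + 5) u v ∨ Dir (4 * i + 1) (4 * i + 2) u v) ∨
  Dir 1 2 u v ∨ Dir (2 * k - 6) (2 * k - 1) u v ∨ Dir (2 * k - 3) (2 * k - 2) u v ∨
  Dir (2 * k - 2) 1 u v ∨ Dir (2 * k - 2) 5 u v ∨ Dir (2 * k - 1) (2 * k - 2) u v

/-- The edges of `S_k` for odd `k ≥ 5`. -/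
def oddAdj (k u v : ℕ) : Prop :=
  (∃ i ∈ Finset.Icc 1 ((k - 1) / 2),
    Und (4 * i - 2) (4 * i - 1) u v ∨ Und (4 * i - 1) (4 * i) u v ∨
      Und (4 * i) (4 * i + 1) u v) ∨
  (∃ i ∈ Finset.Icc 1 ((k - 3) / 2),
    Dir (4 * i - 2) (4 * i + 5) u v ∨ Dir (4 * i + 1) (4 * i + 2) u v) ∨
  Dir 1 2 u v ∨ Dir (2 * k - 4) 1 u v ∨ Dir (2 * k - 2) 5 u v

/-- The vertices of `S_k` are `1, …, 2k - 1`. -/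
abbrev SVertex (k : ℕ) : Type := Finset.Icc 1 (2 * k - 1)

/-- The digraph `S_k`. -/
def S (k : ℕ) : Digraph (SVertex k) where
  Adj u v := (Even k ∧ evenAdj k u v) ∨ (Odd k ∧ oddAdj k u v)

/-- The number of the incoming vertex `i_j`, for `1 ≤ j ≤ k`. -/
def inNum (j : ℕ) : ℕ := 2 * j - 1

/-- The number of the outgoing vertex `o_j`, for `1 ≤ j ≤ k`. The last two lines are
`o_{2t} = 4t + 3` and `o_{2t+1} = 4t - 3`. -/
def outNum (k j : ℕ) : ℕ :=
  if Even k then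
    if j = 1 then 3
    else if j = k - 2 then 2 * k - 1
    else if j = k - 1 then 2 * k - 7
    else if j = k then 2 * k - 3
    else if Even j then 4 * (j / 2) + 3
    else 4 * (j / 2) - 3
  else
    if j = 1 then 2 * k - 1
    else if j = k - 1 then 3
    else if j = k then 2 * k - 5
    else if Even j then 4 * (j / 2) + 3
    else 4 * (j / 2) - 3

theorem inNum_mem {k j : ℕ} (h1 : 1 ≤ j) (hj : j ≤ k) :
    inNum j ∈ Finset.Icc 1 (2 * k - 1) := by
  simp only [inNum, Finset.mem_Icc]
  omega

theorem outNum_mem {k j : ℕ} (hk : 4 ≤ k) (h1 : 1 ≤ j) (hj : j ≤ k) :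
    outNum k j ∈ Finset.Icc 1 (2 * k - 1) := by
  simp only [outNum, Finset.mem_Icc, Nat.even_iff]
  split_ifs <;> omega

/-- The incoming vertices of `S_k`; the index `j : Fin k` stands for the label `j + 1`. -/
def inVertex (k : ℕ) (j : Fin k) : SVertex k :=
  ⟨inNum (j + 1), inNum_mem (by omega) j.isLt⟩

/-- The outgoing vertices of `S_k`; the index `j : Fin k` stands for the label `j + 1`. -/
def outVertex (k : ℕ) (hk : 4 ≤ k) (j : Fin k) : SVertex k :=
  ⟨outNum k (j + 1), outNum_mem hk (by omega) j.isLt⟩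

/-- The odd-numbered vertices of `S_k`. -/
def oddPart (k : ℕ) : Set (SVertex k) := {v | Odd (v : ℕ)}

end InOut

/-!
The argument has a part on all in-out graphs and a part on `S_k`.

*General in-out graphs.* A Hamiltonian path from `i_j` to `o_j` cannot step from an outgoing to an
incoming vertex, since cutting it there would violate the single visit condition. So among its
`|V| - 1` steps, the `k - 1` steps leaving an outgoing vertex and the `k - 1` steps entering an
incoming vertex are all different, and `|V| ≥ 2k - 1` (`stepOf_injective`). If equality holds, every
step is of one of the two kinds. Hence a non-incoming vertex is entered from an outgoing vertex
other than `o_j`, and a non-outgoing vertex is left towards an incoming vertex other than `i_j`.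
Varying `j` gives two such edges at each of the `k - 1` non-incoming vertices and at each of the
`k - 1` non-outgoing ones, in total `4(k - 1)` edges
(`IsInOutGraph.four_mul_sub_four_le_edgeCount`). A bipartition as in the theorem forces the single
visit condition because each path of a family contributes exactly one more vertex to the larger part
than to the smaller one (`singleVisit_of_isInOutBipartition`).

*Hamiltonian paths of `S_k`.* Write `k = 2m + 2` or `k = 2m + 1`; the vertices `4i - 2`, `4i - 1`,
`4i`, `4i + 1` form block `i ≤ m`. The paths between paired vertices are written down explicitly:
they run through some blocks upwards and through the others downwards (`segment_even`,
`segment_odd`). For the converse, the edges from odd to even vertices form the path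
`1, 2, …, 2k - 1` when their directions are forgotten. So the end `o` of a Hamiltonian path
determines the successors of all odd vertices: those below `o` step up and those above `o` step down
(`IsHamStep.enter_below`, `IsHamStep.enter_above`). The edges from even to odd vertices also form a
path, up to one additional edge for odd `k` that is treated
separately (`leave_of_extra`), so the start `s` determines
the successors of the even vertices (`IsHamStep.leave_before`, `IsHamStep.leave_after`). For every
block, avoiding a 2-cycle at its third vertex relates `s` and `o` (`IsHamStep.four_mul_lt_iff`).
These conditions leave only the vertex `o` paired with `s` and vertices `o` that the walk from `s`
already reaches as its first or third vertex (`eq_evenPartner`, `eq_oddPartner`).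
-/

namespace InOut

/-! ### Hamiltonian paths as vertex numberings -/

/-- `π` numbers the vertices `0, 1, …, |V| - 1` in the order of a Hamiltonian path of `G` from `u`
to `v`. -/
structure IsHamOrder {V : Type*} (G : Digraph V) (u v : V) (π : V → ℕ) : Prop where
  inj : Function.Injective π
  start : π u = 0
  finish : π v + 1 = Nat.card V
  lt_card : ∀ w, π w < Nat.card V
  surj : ∀ t, t < Nat.card V → ∃ w, π w = t
  adj : ∀ a b, π b = π a + 1 → G.Adj a b

theorem isHamOrder_idxOf {V : Type*} [Finite V] [DecidableEq V] {G : Digraph V} {u v : V}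
    {p : List V} (hp : IsPath G u v p) (hc : ∀ w, w ∈ p) : IsHamOrder G u v p.idxOf := by
  obtain ⟨hu, hv, hn, hch⟩ := hp
  have hcard : Nat.card V = p.length := by
    have := Fintype.ofFinite V
    rw [Nat.card_eq_fintype_card, ← List.toFinset_card_of_nodup hn, ← Finset.card_univ]
    congr 1
    ext w
    simp [hc w]
  have hne : p ≠ [] := List.ne_nil_of_mem (hc u)
  have hpos : 0 < p.length := List.length_pos_iff.2 hne
  refine ⟨?_, ?_, ?_, ?_, ?_, ?_⟩
  · intro a b h
    exact (List.idxOf_inj (hc a)).1 h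
  · cases p with
    | nil => simp at hu
    | cons x l => simp at hu; simp [hu]
  · rw [List.getLast?_eq_getElem?, List.getElem?_eq_some_iff] at hv
    obtain ⟨h, rfl⟩ := hv
    rw [hn.idxOf_getElem, hcard]
    omega
  · intro w
    rw [hcard]
    exact List.idxOf_lt_length_of_mem (hc w)
  · intro t ht
    rw [hcard] at ht
    exact ⟨p[t], hn.idxOf_getElem t ht⟩
  · intro a b h
    have ha := List.idxOf_lt_length_of_mem (hc a)
    have hb := List.idxOf_lt_length_of_mem (hc b)
    have := List.isChain_iff_getElem.1 hch (p.idxOf a) (by omega)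
    simpa only [← h, List.getElem_idxOf] using this

theorem HasHamiltonianPath.exists_order {V : Type*} [Finite V] {G : Digraph V} {u v : V}
    (h : HasHamiltonianPath G u v) : ∃ π, IsHamOrder G u v π := by
  classical
  obtain ⟨p, hp, hc⟩ := h
  exact ⟨_, isHamOrder_idxOf hp hc⟩

namespace IsHamOrder

variable {V : Type*} {G : Digraph V} {u v : V} {π : V → ℕ}

theorem exists_succ (h : IsHamOrder G u v π) {w : V} (hw : w ≠ v) :
    ∃ x, π x = π w + 1 ∧ G.Adj w x := by
  have h1 := h.lt_card w
  have h2 := h.finish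
  have h3 : π w ≠ π v := fun e => hw (h.inj e)
  obtain ⟨x, hx⟩ := h.surj (π w + 1) (by omega)
  exact ⟨x, hx, h.adj _ _ hx⟩

theorem exists_pred (h : IsHamOrder G u v π) {w : V} (hw : w ≠ u) :
    ∃ x, π w = π x + 1 ∧ G.Adj x w := by
  have h1 := h.lt_card w
  have h2 := h.start
  have h3 : π w ≠ π u := fun e => hw (h.inj e)
  obtain ⟨x, hx⟩ := h.surj (π w - 1) (by omega)
  exact ⟨x, by omega, h.adj _ _ (by omega)⟩

end IsHamOrder

/-! ### Order and size of in-out graphs -/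

section General

variable {V : Type*} {G : Digraph V} {k : ℕ} {inc out : Fin k → V}

/-- A Hamiltonian path of an in-out graph never steps from an outgoing vertex to an incoming one:
cutting it there would give two paths violating the single visit condition. -/
theorem IsInOutGraph.exists_order [Finite V] (h : IsInOutGraph G inc out) (j : Fin k) :
    ∃ π, IsHamOrder G (inc j) (out j) π ∧ ∀ m m', π (inc m') ≠ π (out m) + 1 := by
  classical
  obtain ⟨p, hp, hc⟩ := (h.paired j j).2 rfl
  refine ⟨_, isHamOrder_idxOf hp hc, fun m m' hmm => h.single ?_⟩
  obtain ⟨hu, hv, hn, hch⟩ := hp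
  set t := p.idxOf (out m) with ht
  have hlt : t + 1 < p.length := by
    rw [← hmm]; exact List.idxOf_lt_length_of_mem (hc _)
  have ho : p[t] = out m := List.getElem_idxOf _
  have hi : p[t + 1] = inc m' := by
    have := List.getElem_idxOf (List.idxOf_lt_length_of_mem (hc (inc m')))
    simpa only [hmm] using this
  have hsplit : p.take (t + 1) ++ p.drop (t + 1) = p := List.take_append_drop _ _
  have hn' := hn
  have hch' := hch
  rw [← hsplit, List.nodup_append'] at hn'
  rw [← hsplit, List.isChain_append] at hch'
  refine ⟨2, ![p.take (t + 1), p.drop (t + 1)], le_rfl, ?_, ?_, ?_⟩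
  · intro a
    fin_cases a
    · refine ⟨j, m, ?_, ?_, hn'.1, hch'.1⟩
      · simpa [List.head?_take] using hu
      · simp [List.getLast?_take, ← ho, List.getElem?_eq_getElem (show t < p.length by omega)]
    · refine ⟨m', j, ?_, ?_, hn'.2.1, hch'.2.1⟩
      · simp [List.head?_drop, ← hi, List.getElem?_eq_getElem hlt]
      · simpa [List.getLast?_drop, show ¬ p.length ≤ t + 1 by omega] using hv
  · intro a b hab
    fin_cases a <;> fin_cases b
    · exact absurd rfl hab
    · exact hn'.2.2
    · exact hn'.2.2.symm
    · exact absurd rfl hab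
  · intro w
    have := hc w
    rw [← hsplit, List.mem_append] at this
    rcases this with hw | hw
    · exact ⟨0, hw⟩
    · exact ⟨1, hw⟩

/-- The steps of the `j`-th Hamiltonian path that leave an outgoing vertex `out m`, and those that
enter an incoming vertex `inc m`; in both cases `m ≠ j`. The step from position `t` to position
`t + 1` has number `t`. -/
def stepOf (π : V → ℕ) (inc out : Fin k → V) (j : Fin k) :
    {m : Fin k // m ≠ j} ⊕ {m : Fin k // m ≠ j} → ℕ :=
  Sum.elim (fun m => π (out m)) (fun m => π (inc m) - 1)

theorem stepOf_injective (h : IsInOutGraph G inc out) {j : Fin k} {π : V → ℕ}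
    (hπ : IsHamOrder G (inc j) (out j) π) (hs : ∀ m m', π (inc m') ≠ π (out m) + 1) :
    Function.Injective (stepOf π inc out j) := by
  have hpos : ∀ m : {m : Fin k // m ≠ j}, π (inc m) ≠ 0 := fun m e =>
    m.2 (h.inc_injective (hπ.inj (e.trans hπ.start.symm)))
  rintro (a | a) (b | b) hab <;> simp only [stepOf, Sum.elim_inl, Sum.elim_inr] at hab
  · rw [Subtype.ext (h.out_injective (hπ.inj hab))]
  · exact absurd (by have := hpos b; omega) (hs a b)
  · exact absurd (by have := hpos a; omega) (hs b a)
  · rw [Subtype.ext (h.inc_injective (hπ.inj (show π (inc a) = π (inc b) by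
      have := hpos a; have := hpos b; omega)))]

theorem stepOf_lt (h : IsInOutGraph G inc out) {j : Fin k} {π : V → ℕ}
    (hπ : IsHamOrder G (inc j) (out j) π) (x) : stepOf π inc out j x < Nat.card V - 1 := by
  have hf := hπ.finish
  rcases x with a | a <;> simp only [stepOf, Sum.elim_inl, Sum.elim_inr]
  · have h1 := hπ.lt_card (out a)
    have h2 : π (out a) ≠ π (out j) := fun e => a.2 (h.out_injective (hπ.inj e))
    omega
  · have h1 := hπ.lt_card (inc a)
    have h2 : π (inc a) ≠ π (inc j) := fun e => a.2 (h.inc_injective (hπ.inj e))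
    rw [hπ.start] at h2
    omega

theorem card_sum_ne (j : Fin k) :
    Fintype.card ({m : Fin k // m ≠ j} ⊕ {m : Fin k // m ≠ j}) = 2 * (k - 1) := by
  rw [Fintype.card_sum, Fintype.card_subtype, Finset.filter_ne', Finset.card_erase_of_mem
    (Finset.mem_univ j), Finset.card_univ, Fintype.card_fin]
  omega

theorem IsInOutGraph.two_mul_sub_one_le_card [Finite V] (h : IsInOutGraph G inc out) (hk : 0 < k) :
    2 * k - 1 ≤ Nat.card V := by
  obtain ⟨π, hπ, hs⟩ := h.exists_order ⟨0, hk⟩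
  have hinj : Function.Injective fun x => (⟨_, stepOf_lt h hπ x⟩ : Fin (Nat.card V - 1)) :=
    fun a b e => stepOf_injective h hπ hs (congrArg Fin.val e)
  have := Fintype.card_le_of_injective _ hinj
  rw [card_sum_ne, Fintype.card_fin] at this
  have := hπ.finish
  omega

/-- In an in-out graph of the minimal order, every step of the `j`-th Hamiltonian path leaves an
outgoing vertex or enters an incoming vertex. -/
theorem IsInOutGraph.exists_stepOf_eq [Finite V] (h : IsInOutGraph G inc out)
    (hV : Nat.card V = 2 * k - 1) {j : Fin k} {π : V → ℕ}
    (hπ : IsHamOrder G (inc j) (out j) π) (hs : ∀ m m', π (inc m') ≠ π (out m) + 1)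
    {t : ℕ} (ht : t < Nat.card V - 1) : ∃ x, stepOf π inc out j x = t := by
  have hinj : Function.Injective fun x => (⟨_, stepOf_lt h hπ x⟩ : Fin (Nat.card V - 1)) :=
    fun a b e => stepOf_injective h hπ hs (congrArg Fin.val e)
  have hbij := (Fintype.bijective_iff_injective_and_card _).2 ⟨hinj, by
    rw [card_sum_ne, Fintype.card_fin]; omega⟩
  obtain ⟨x, hx⟩ := hbij.2 ⟨t, ht⟩
  exact ⟨x, congrArg Fin.val hx⟩

theorem IsInOutGraph.exists_adj_of_notMem_inc [Finite V] (h : IsInOutGraph G inc out)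
    (hV : Nat.card V = 2 * k - 1) (j : Fin k) {w : V} (hw : w ∉ Set.range inc) :
    ∃ m ≠ j, G.Adj (out m) w := by
  obtain ⟨π, hπ, hs⟩ := h.exists_order j
  have h0 : π w ≠ 0 := fun e => hw ⟨j, hπ.inj (hπ.start.trans e.symm)⟩
  have h1 := hπ.lt_card w
  obtain ⟨m | m, hm⟩ := h.exists_stepOf_eq hV hπ hs (t := π w - 1) (by omega) <;>
    simp only [stepOf, Sum.elim_inl, Sum.elim_inr] at hm
  · exact ⟨m, m.2, hπ.adj _ _ (by omega)⟩
  · have : π (inc m) ≠ 0 := fun e => m.2 (h.inc_injective (hπ.inj (e.trans hπ.start.symm)))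
    exact absurd ⟨m, hπ.inj (by omega)⟩ hw

theorem IsInOutGraph.exists_adj_of_notMem_out [Finite V] (h : IsInOutGraph G inc out)
    (hV : Nat.card V = 2 * k - 1) (j : Fin k) {v : V} (hv : v ∉ Set.range out) :
    ∃ m ≠ j, G.Adj v (inc m) := by
  obtain ⟨π, hπ, hs⟩ := h.exists_order j
  have h0 : π v ≠ π (out j) := fun e => hv ⟨j, hπ.inj e.symm⟩
  have h1 := hπ.lt_card v
  have h2 := hπ.finish
  obtain ⟨m | m, hm⟩ := h.exists_stepOf_eq hV hπ hs (t := π v) (by omega) <;>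
    simp only [stepOf, Sum.elim_inl, Sum.elim_inr] at hm
  · exact absurd ⟨m, hπ.inj hm⟩ hv
  · have : π (inc m) ≠ 0 := fun e => m.2 (h.inc_injective (hπ.inj (e.trans hπ.start.symm)))
    exact ⟨m, m.2, hπ.adj _ _ (by omega)⟩

theorem card_notMem_range [Finite V] (hV : Nat.card V = 2 * k - 1) {f : Fin k → V}
    (hf : Function.Injective f) : Nat.card {w // w ∉ Set.range f} = k - 1 := by
  have h1 : (Set.range f).ncard = k := by
    rw [← Set.image_univ, Set.ncard_image_of_injective _ hf, Set.ncard_univ, Nat.card_fin]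
  have h2 := Set.ncard_add_ncard_compl (Set.range f)
  have h3 : Nat.card {w // w ∉ Set.range f} = (Set.range f)ᶜ.ncard := rfl
  omega

/-- Non-incoming vertices have at least two in-neighbours and non-outgoing ones at least two
out-neighbours, where the latter edges end in incoming vertices, so that no edge is counted
twice. -/
theorem IsInOutGraph.four_mul_sub_four_le_edgeCount [Finite V] (h : IsInOutGraph G inc out)
    (hk : 0 < k) (hV : Nat.card V = 2 * k - 1) : 4 * k - 4 ≤ edgeCount G := by
  choose f hf hfa using fun (w : {w // w ∉ Set.range inc}) (j : Fin k) =>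
    h.exists_adj_of_notMem_inc hV j w.2
  choose g hg hga using fun (v : {v // v ∉ Set.range out}) (j : Fin k) =>
    h.exists_adj_of_notMem_out hV j v.2
  let j₀ : Fin k := ⟨0, hk⟩
  let f' (w : {w // w ∉ Set.range inc}) (b : Bool) : Fin k := f w (bif b then j₀ else f w j₀)
  let g' (v : {v // v ∉ Set.range out}) (b : Bool) : Fin k := g v (bif b then j₀ else g v j₀)
  have hf' : ∀ w, Function.Injective (f' w) := by
    rintro w (_ | _) (_ | _) e
    · rfl
    · exact absurd e (hf w _)
    · exact absurd e.symm (hf w _)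
    · rfl
  have hg' : ∀ v, Function.Injective (g' v) := by
    rintro w (_ | _) (_ | _) e
    · rfl
    · exact absurd e (hg w _)
    · exact absurd e.symm (hg w _)
    · rfl
  let F : ({w // w ∉ Set.range inc} × Bool) ⊕ ({v // v ∉ Set.range out} × Bool) →
      {e : V × V | G.Adj e.1 e.2} :=
    Sum.elim (fun x => ⟨(out (f' x.1 x.2), x.1), hfa _ _⟩)
      (fun x => ⟨(x.1, inc (g' x.1 x.2)), hga _ _⟩)
  have hF : Function.Injective F := by
    rintro (⟨a, x⟩ | ⟨a, x⟩) (⟨b, y⟩ | ⟨b, y⟩) e <;>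
      simp only [F, Sum.elim_inl, Sum.elim_inr, Subtype.mk.injEq, Prod.mk.injEq] at e
    · obtain rfl := Subtype.ext e.2
      rw [hf' _ (h.out_injective e.1)]
    · exact absurd ⟨_, e.2.symm⟩ a.2
    · exact absurd ⟨_, e.2⟩ b.2
    · obtain rfl := Subtype.ext e.1
      rw [hg' _ (h.inc_injective e.2)]
  have := Nat.card_le_card_of_injective F hF
  rw [Nat.card_sum, Nat.card_prod, Nat.card_prod, card_notMem_range hV h.inc_injective,
    card_notMem_range hV h.out_injective, Nat.card_eq_fintype_card (α := Bool),
    Fintype.card_bool] at this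
  change 4 * k - 4 ≤ Nat.card {e : V × V | G.Adj e.1 e.2}
  omega

end General

/-! ### Bipartitions force the single visit condition -/

/-- A path that alternates between `A` and its complement and ends in `A` has as many vertices in
`A` as outside, plus one if it also starts in `A`. -/
theorem countP_of_alternating {V : Type*} (A : V → Bool) {R : V → V → Prop}
    (hR : ∀ u v, R u v → (A u = !A v)) (x : V) (l : List V) (hl : (x :: l).IsChain R) {y : V}
    (hy : (x :: l).getLast? = some y) (hyA : A y) :
    (x :: l).countP A = (x :: l).countP (fun v => !A v) + (A x).toNat := by
  induction l generalizing x with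
  | nil =>
    simp at hy
    subst hy
    simp [hyA]
  | cons z l ih =>
    rw [List.isChain_cons_cons] at hl
    have := ih z hl.2 (by simpa [List.getLast?_cons_cons] using hy)
    rw [List.countP_cons, List.countP_cons (p := fun v => !A v), this, hR x z hl.1]
    cases A z <;> simp

theorem singleVisit_of_isInOutBipartition {V : Type*} [Finite V] {G : Digraph V} {n : ℕ}
    {inc out : Fin n → V} {A : Set V} (h : IsInOutBipartition G inc out A) :
    SingleVisit G inc out := by
  classical
  have := Fintype.ofFinite V
  rintro ⟨N, p, hN, hp, hdis, hcov⟩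
  obtain ⟨hA, hcard, hinc, hout⟩ := h
  have key (B : Set V) : B.ncard = ∑ a, (p a).countP (fun v => decide (v ∈ B)) := by
    have e : B.toFinset = Finset.univ.biUnion
        fun a => ((p a).filter (fun v => decide (v ∈ B))).toFinset := by
      ext w
      simpa using fun _ => hcov w
    rw [Set.ncard_eq_toFinset_card', e, Finset.card_biUnion]
    · refine Finset.sum_congr rfl fun a _ => ?_
      obtain ⟨_, _, hpa⟩ := hp a
      rw [List.toFinset_card_of_nodup (hpa.2.2.1.filter _), List.countP_eq_length_filter]
    · intro a _ b _ hab
      rw [Function.onFun, List.disjoint_toFinset_iff_disjoint]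
      exact fun w h1 h2 => hdis a b hab (List.mem_filter.1 h1).1 (List.mem_filter.1 h2).1
  have hpath (a) : (p a).countP (fun v => decide (v ∈ A)) =
      (p a).countP (fun v => decide (v ∈ Aᶜ)) + 1 := by
    obtain ⟨j, m, hh, hl, -, hc⟩ := hp a
    cases hpa : p a with
    | nil => simp [hpa] at hh
    | cons x l =>
      rw [hpa] at hh hl hc
      obtain rfl : x = inc j := by simpa using hh
      have := countP_of_alternating (fun v => decide (v ∈ A)) (R := G.Adj)
        (fun u v huv => by by_cases hv : v ∈ A <;> simp [hA u v huv, hv]) _ l hc hl (by simp [hout])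
      simpa [hinc] using this
  rw [key A, key Aᶜ, Finset.sum_congr rfl fun a _ => hpath a, Finset.sum_add_distrib] at hcard
  simp at hcard
  omega

/-! ### Arithmetic description of the edges of `S_k` -/

/-- The edges of `S_k` for `k = 2m + 2`: an odd vertex sends edges to the even vertices next to it,
and an even vertex `u` sends edges to the odd vertices given by `u mod 4`. -/
theorem evenAdj_iff {m u v : ℕ} (hm : 1 ≤ m) : evenAdj (2 * m + 2) u v ↔
    1 ≤ u ∧ u ≤ 4 * m + 3 ∧ 1 ≤ v ∧ v ≤ 4 * m + 3 ∧
      (v % 2 = 0 ∧ (u + 1 = v ∨ u = v + 1) ∨ u % 4 = 0 ∧ (v = u + 1 ∨ v + 1 = u) ∨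
        u % 4 = 2 ∧ u + 2 < 4 * m ∧ (v = u + 1 ∨ v = u + 7) ∨
        u + 2 = 4 * m ∧ (v = u + 1 ∨ v = u + 5) ∨ u = 4 * m + 2 ∧ (v = 1 ∨ v = 5)) := by
  have e1 : (2 * m + 2 - 2) / 2 = m := by omega
  have e2 : (2 * m + 2 - 4) / 2 = m - 1 := by omega
  simp only [evenAdj, Und, Dir, Finset.mem_Icc, e1, e2]
  constructor
  · rintro (⟨i, hi, (h | h) | (h | h) | h | h⟩ | ⟨i, hi, h | h⟩ | h | h | h | h | h | h) <;>
      refine ⟨by omega, by omega, by omega, by omega, ?_⟩ <;> obtain ⟨rfl, rfl⟩ := h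
    · by_cases h : i = m
      · exact Or.inr (Or.inr (Or.inr (Or.inl ⟨by omega, Or.inl (by omega)⟩)))
      · exact Or.inr (Or.inr (Or.inl ⟨by omega, by omega, Or.inl (by omega)⟩))
    · exact Or.inl ⟨by omega, Or.inr (by omega)⟩
    · exact Or.inl ⟨by omega, Or.inl (by omega)⟩
    · exact Or.inr (Or.inl ⟨by omega, Or.inr (by omega)⟩)
    · exact Or.inr (Or.inl ⟨by omega, Or.inl (by omega)⟩)
    · exact Or.inl ⟨by omega, Or.inr (by omega)⟩
    · exact Or.inr (Or.inr (Or.inl ⟨by omega, by omega, Or.inr (by omega)⟩))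
    · exact Or.inl ⟨by omega, Or.inl (by omega)⟩
    · exact Or.inl ⟨by omega, Or.inl (by omega)⟩
    · exact Or.inr (Or.inr (Or.inr (Or.inl ⟨by omega, Or.inr (by omega)⟩)))
    · exact Or.inl ⟨by omega, Or.inl (by omega)⟩
    · exact Or.inr (Or.inr (Or.inr (Or.inr ⟨by omega, Or.inl rfl⟩)))
    · exact Or.inr (Or.inr (Or.inr (Or.inr ⟨by omega, Or.inr rfl⟩)))
    · exact Or.inl ⟨by omega, Or.inr (by omega)⟩
  · rintro ⟨h1, h2, h3, h4, ⟨hv, h | h⟩ | ⟨hu, h | h⟩ | ⟨hu, hlt, h | h⟩ |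
      ⟨hu, h | h⟩ | ⟨hu, h | h⟩⟩
    · rcases (by omega : v % 4 = 0 ∨ v = 2 ∨ v = 4 * m + 2 ∨ v % 4 = 2 ∧ 2 < v ∧ v < 4 * m + 2)
        with h' | h' | h' | h'
      · exact Or.inl ⟨v / 4, by omega, Or.inr (Or.inl (Or.inl ⟨by omega, by omega⟩))⟩
      · exact Or.inr (Or.inr (Or.inl ⟨by omega, h'⟩))
      · exact Or.inr (Or.inr (Or.inr (Or.inr (Or.inl ⟨by omega, by omega⟩))))
      · exact Or.inr (Or.inl ⟨u / 4, by omega, Or.inr ⟨by omega, by omega⟩⟩)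
    · rcases (by omega : v % 4 = 0 ∨ v = 4 * m + 2 ∨ v % 4 = 2 ∧ v < 4 * m + 2) with h' | h' | h'
      · exact Or.inl ⟨v / 4, by omega, Or.inr (Or.inr (Or.inr ⟨by omega, by omega⟩))⟩
      · exact Or.inr (Or.inr (Or.inr (Or.inr (Or.inr (Or.inr (Or.inr ⟨by omega, by omega⟩))))))
      · exact Or.inl ⟨v / 4 + 1, by omega, Or.inl (Or.inr ⟨by omega, by omega⟩)⟩
    · exact Or.inl ⟨u / 4, by omega, Or.inr (Or.inr (Or.inl ⟨by omega, by omega⟩))⟩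
    · exact Or.inl ⟨u / 4, by omega, Or.inr (Or.inl (Or.inr ⟨by omega, by omega⟩))⟩
    · exact Or.inl ⟨u / 4 + 1, by omega, Or.inl (Or.inl ⟨by omega, by omega⟩)⟩
    · exact Or.inr (Or.inl ⟨u / 4 + 1, by omega, Or.inl ⟨by omega, by omega⟩⟩)
    · exact Or.inl ⟨m, by omega, Or.inl (Or.inl ⟨by omega, by omega⟩)⟩
    · exact Or.inr (Or.inr (Or.inr (Or.inl ⟨by omega, by omega⟩)))
    · exact Or.inr (Or.inr (Or.inr (Or.inr (Or.inr (Or.inl ⟨by omega, h⟩)))))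
    · exact Or.inr (Or.inr (Or.inr (Or.inr (Or.inr (Or.inr (Or.inl ⟨by omega, h⟩))))))

/-- The edges of `S_k` for `k = 2m + 1`. -/
theorem oddAdj_iff {m u v : ℕ} (hm : 2 ≤ m) : oddAdj (2 * m + 1) u v ↔
    1 ≤ u ∧ u ≤ 4 * m + 1 ∧ 1 ≤ v ∧ v ≤ 4 * m + 1 ∧
      (v % 2 = 0 ∧ (u + 1 = v ∨ u = v + 1) ∨ u % 4 = 0 ∧ (v = u + 1 ∨ v + 1 = u) ∨
        u % 4 = 2 ∧ u + 2 < 4 * m ∧ (v = u + 1 ∨ v = u + 7) ∨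
        u + 2 = 4 * m ∧ (v = u + 1 ∨ v = 1) ∨ u = 4 * m ∧ v = 5) := by
  have e1 : (2 * m + 1 - 1) / 2 = m := by omega
  have e2 : (2 * m + 1 - 3) / 2 = m - 1 := by omega
  simp only [oddAdj, Und, Dir, Finset.mem_Icc, e1, e2]
  constructor
  · rintro (⟨i, hi, (h | h) | (h | h) | h | h⟩ | ⟨i, hi, h | h⟩ | h | h | h) <;>
      refine ⟨by omega, by omega, by omega, by omega, ?_⟩ <;> obtain ⟨rfl, rfl⟩ := h
    · by_cases h : i = m
      · exact Or.inr (Or.inr (Or.inr (Or.inl ⟨by omega, Or.inl (by omega)⟩)))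
      · exact Or.inr (Or.inr (Or.inl ⟨by omega, by omega, Or.inl (by omega)⟩))
    · exact Or.inl ⟨by omega, Or.inr (by omega)⟩
    · exact Or.inl ⟨by omega, Or.inl (by omega)⟩
    · exact Or.inr (Or.inl ⟨by omega, Or.inr (by omega)⟩)
    · exact Or.inr (Or.inl ⟨by omega, Or.inl (by omega)⟩)
    · exact Or.inl ⟨by omega, Or.inr (by omega)⟩
    · exact Or.inr (Or.inr (Or.inl ⟨by omega, by omega, Or.inr (by omega)⟩))
    · exact Or.inl ⟨by omega, Or.inl (by omega)⟩
    · exact Or.inl ⟨by omega, Or.inl (by omega)⟩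
    · exact Or.inr (Or.inr (Or.inr (Or.inl ⟨by omega, Or.inr rfl⟩)))
    · exact Or.inr (Or.inr (Or.inr (Or.inr ⟨by omega, rfl⟩)))
  · rintro ⟨h1, h2, h3, h4, ⟨hv, h | h⟩ | ⟨hu, h | h⟩ | ⟨hu, hlt, h | h⟩ | ⟨hu, h | h⟩ | ⟨hu, h⟩⟩
    · rcases (by omega : v % 4 = 0 ∨ v = 2 ∨ v % 4 = 2 ∧ 2 < v) with h' | h' | h'
      · exact Or.inl ⟨v / 4, by omega, Or.inr (Or.inl (Or.inl ⟨by omega, by omega⟩))⟩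
      · exact Or.inr (Or.inr (Or.inl ⟨by omega, h'⟩))
      · exact Or.inr (Or.inl ⟨u / 4, by omega, Or.inr ⟨by omega, by omega⟩⟩)
    · rcases (by omega : v % 4 = 0 ∨ v % 4 = 2) with h' | h'
      · exact Or.inl ⟨v / 4, by omega, Or.inr (Or.inr (Or.inr ⟨by omega, by omega⟩))⟩
      · exact Or.inl ⟨v / 4 + 1, by omega, Or.inl (Or.inr ⟨by omega, by omega⟩)⟩
    · exact Or.inl ⟨u / 4, by omega, Or.inr (Or.inr (Or.inl ⟨by omega, by omega⟩))⟩
    · exact Or.inl ⟨u / 4, by omega, Or.inr (Or.inl (Or.inr ⟨by omega, by omega⟩))⟩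
    · exact Or.inl ⟨u / 4 + 1, by omega, Or.inl (Or.inl ⟨by omega, by omega⟩)⟩
    · exact Or.inr (Or.inl ⟨u / 4 + 1, by omega, Or.inl ⟨by omega, by omega⟩⟩)
    · exact Or.inl ⟨m, by omega, Or.inl (Or.inl ⟨by omega, by omega⟩)⟩
    · exact Or.inr (Or.inr (Or.inr (Or.inl ⟨by omega, h⟩)))
    · exact Or.inr (Or.inr (Or.inr (Or.inr ⟨by omega, h⟩)))

theorem S_adj_even {m : ℕ} {u v : SVertex (2 * m + 2)} :
    (S (2 * m + 2)).Adj u v ↔ evenAdj (2 * m + 2) u v := by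
  have h1 : Even (2 * m + 2) := ⟨m + 1, by omega⟩
  have h2 : ¬ Odd (2 * m + 2) := by simp [h1]
  simp [S, h1, h2]

theorem S_adj_odd {m : ℕ} {u v : SVertex (2 * m + 1)} :
    (S (2 * m + 1)).Adj u v ↔ oddAdj (2 * m + 1) u v := by
  have h1 : Odd (2 * m + 1) := ⟨m, rfl⟩
  have h2 : ¬ Even (2 * m + 1) := by simp
  simp [S, h1, h2]

theorem four_le_cases {k : ℕ} (hk : 4 ≤ k) :
    (∃ m, 1 ≤ m ∧ k = 2 * m + 2) ∨ ∃ m, 2 ≤ m ∧ k = 2 * m + 1 := by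
  rcases Nat.even_or_odd' k with ⟨n, h | h⟩
  · exact Or.inl ⟨n - 1, by omega, by omega⟩
  · exact Or.inr ⟨n, by omega, h⟩

/-! ### The bipartition of `S_k` -/

theorem card_SVertex (k : ℕ) : Nat.card (SVertex k) = 2 * k - 1 := by
  rw [Nat.card_eq_fintype_card, Fintype.card_coe, Nat.card_Icc]
  omega

theorem ncard_oddPart {k : ℕ} (hk : 1 ≤ k) : (oddPart k).ncard = k := by
  let f : Fin k → SVertex k := fun j => ⟨2 * j + 1, by rw [Finset.mem_Icc]; omega⟩
  have hf : Function.Injective f := fun a b h => by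
    have := congrArg Subtype.val h
    simp only [f] at this
    omega
  have : oddPart k = f '' Set.univ := by
    ext ⟨v, hv⟩
    rw [Finset.mem_Icc] at hv
    simp only [oddPart, Set.mem_ofPred_eq, Set.image_univ, Set.mem_range, f, Subtype.mk.injEq]
    constructor
    · rintro ⟨j, hj⟩
      exact ⟨⟨j, by omega⟩, hj.symm⟩
    · rintro ⟨j, hj⟩
      exact ⟨j, hj.symm⟩
  rw [this, Set.ncard_image_of_injective _ hf, Set.ncard_univ, Nat.card_fin]

theorem ncard_compl_oddPart {k : ℕ} (hk : 1 ≤ k) : (oddPart k)ᶜ.ncard = k - 1 := by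
  have h1 := Set.ncard_add_ncard_compl (oddPart k)
  rw [ncard_oddPart hk, card_SVertex] at h1
  omega

theorem S_isInOutBipartition (k : ℕ) (hk : 4 ≤ k) :
    IsInOutBipartition (S k) (inVertex k) (outVertex k hk) (oddPart k) := by
  refine ⟨?_, ?_, ?_, ?_⟩
  · intro u v huv
    simp only [oddPart, Set.mem_ofPred_eq, Nat.odd_iff]
    rcases four_le_cases hk with ⟨m, hm, rfl⟩ | ⟨m, hm, rfl⟩
    · rw [S_adj_even, evenAdj_iff hm] at huv
      omega
    · rw [S_adj_odd, oddAdj_iff hm] at huv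
      omega
  · rw [ncard_oddPart (by omega), ncard_compl_oddPart (by omega)]
    omega
  · intro j
    simp only [oddPart, inVertex, inNum, Set.mem_ofPred_eq, Nat.odd_iff]
    omega
  · intro j
    simp only [oddPart, outVertex, outNum, Set.mem_ofPred_eq, Nat.odd_iff, Nat.even_iff]
    split_ifs <;> omega

/-! ### The number of edges of `S_k` -/

theorem edgeCount_S (k : ℕ) {R : ℕ → ℕ → Prop} (hR : ∀ u v, (S k).Adj u v ↔ R u v)
    (hb : ∀ u v, R u v → 1 ≤ u ∧ u ≤ 2 * k - 1 ∧ 1 ≤ v ∧ v ≤ 2 * k - 1) :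
    edgeCount (S k) = {e : ℕ × ℕ | R e.1 e.2}.ncard := by
  have hinj : Function.Injective (Prod.map Subtype.val Subtype.val : SVertex k × SVertex k → _) :=
    Subtype.val_injective.prodMap Subtype.val_injective
  rw [edgeCount, ← Set.ncard_image_of_injective _ hinj]
  congr 1
  ext ⟨u, v⟩
  simp only [Set.mem_image, Set.mem_ofPred_eq, Prod.exists, Prod.map_apply, Prod.mk.injEq]
  constructor
  · rintro ⟨a, b, h, rfl, rfl⟩
    exact (hR a b).1 h
  · intro h
    obtain ⟨h1, h2, h3, h4⟩ := hb u v h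
    exact ⟨⟨u, Finset.mem_Icc.2 ⟨h1, h2⟩⟩, ⟨v, Finset.mem_Icc.2 ⟨h3, h4⟩⟩, (hR _ _).2 h, rfl, rfl⟩

/-- The edges between the odd numbers and the even numbers `2, 4, …, 2n` if `2j` has the
in-neighbours `2j - 1` and `2j + 1` and the out-neighbours `f j` and `g j`. -/
def regularArcs (n : ℕ) (f g : ℕ → ℕ) : Set (ℕ × ℕ) :=
  {e | ∃ j, 1 ≤ j ∧ j ≤ n ∧ (e.2 = 2 * j ∧ (e.1 + 1 = 2 * j ∨ e.1 = 2 * j + 1) ∨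
    e.1 = 2 * j ∧ (e.2 = f j ∨ e.2 = g j))}

theorem ncard_regularArcs {n : ℕ} {f g : ℕ → ℕ} (hf : ∀ j, 1 ≤ j → f j % 2 = 1)
    (hg : ∀ j, 1 ≤ j → g j % 2 = 1) (hfg : ∀ j, 1 ≤ j → f j ≠ g j) :
    (regularArcs n f g).Finite ∧ (regularArcs n f g).ncard = 4 * n := by
  let φ : ℕ × Bool × Bool → ℕ × ℕ := fun x =>
    if x.2.1 then (if x.2.2 then 2 * x.1 - 1 else 2 * x.1 + 1, 2 * x.1)
    else (2 * x.1, if x.2.2 then f x.1 else g x.1)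
  have e : regularArcs n f g = ((Finset.Icc 1 n ×ˢ (Finset.univ : Finset (Bool × Bool))).image φ :
      Finset (ℕ × ℕ)) := by
    ext ⟨u, v⟩
    simp only [regularArcs, Set.mem_ofPred_eq, Finset.coe_image, Set.mem_image, Finset.mem_coe,
      Finset.mem_product, Finset.mem_Icc, Finset.mem_univ, and_true, Prod.exists, φ]
    constructor
    · rintro ⟨j, h1, h2, ⟨rfl, h | h⟩ | ⟨rfl, h | h⟩⟩
      · exact ⟨j, true, true, ⟨h1, h2⟩, by simp; omega⟩
      · exact ⟨j, true, false, ⟨h1, h2⟩, by simp [h]⟩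
      · exact ⟨j, false, true, ⟨h1, h2⟩, by simp [h]⟩
      · exact ⟨j, false, false, ⟨h1, h2⟩, by simp [h]⟩
    · rintro ⟨j, _ | _, _ | _, ⟨h1, h2⟩, h⟩ <;> refine ⟨j, h1, h2, ?_⟩ <;>
        simp at h <;> omega
  refine ⟨e ▸ Finset.finite_toSet _, ?_⟩
  rw [e, Set.ncard_coe_finset, Finset.card_image_of_injOn]
  · simp
    omega
  · rintro ⟨i, b, c⟩ hi ⟨j, b', c'⟩ hj h
    simp only [Finset.coe_product, Set.mem_prod, Finset.mem_coe, Finset.mem_Icc] at hi hj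
    have h1 := hf i hi.1.1
    have h2 := hf j hj.1.1
    have h3 := hg i hi.1.1
    have h4 := hg j hj.1.1
    have h5 := hfg i hi.1.1
    cases b <;> cases b' <;> cases c <;> cases c' <;> simp [φ] at h ⊢ <;> try omega
    all_goals
      obtain ⟨rfl, h⟩ := h
      omega

theorem edgeCount_S_even {m : ℕ} (hm : 1 ≤ m) :
    edgeCount (S (2 * m + 2)) = 4 * (2 * m + 2) - 4 := by
  rw [edgeCount_S _ (fun u v => S_adj_even) fun u v h => by
    rw [evenAdj_iff hm] at h; omega]
  have := (ncard_regularArcs (n := 2 * m + 1)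
    (f := fun j => if j = 2 * m + 1 then 1 else 2 * j + 1)
    (g := fun j => if j = 2 * m + 1 then 5 else if j % 2 = 0 then 2 * j - 1 else
      if j + 1 = 2 * m then 2 * j + 5 else 2 * j + 7)
    (fun j hj => by split_ifs <;> omega) (fun j hj => by split_ifs <;> omega)
    (fun j hj => by split_ifs <;> omega)).2
  rw [show 4 * (2 * m + 2) - 4 = 4 * (2 * m + 1) by omega, ← this]
  congr 1
  ext ⟨u, v⟩
  simp only [Set.mem_ofPred_eq, evenAdj_iff hm, regularArcs]
  constructor
  · rintro ⟨h1, h2, h3, h4, h⟩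
    rcases h with ⟨hv, h⟩ | h
    · exact ⟨v / 2, by omega, by omega, Or.inl (by omega)⟩
    · refine ⟨u / 2, by omega, by omega, Or.inr ⟨by omega, ?_⟩⟩
      rcases h with ⟨hu, h | h⟩ | ⟨hu, hlt, h | h⟩ | ⟨hu, h | h⟩ | ⟨hu, h | h⟩ <;>
        split_ifs <;> omega
  · rintro ⟨j, h1, h2, ⟨rfl, h⟩ | ⟨rfl, h⟩⟩
    · exact ⟨by omega, by omega, by omega, by omega, Or.inl ⟨by omega, by omega⟩⟩
    · rcases h with rfl | rfl <;> split_ifs <;>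
        refine ⟨by omega, by omega, by omega, by omega, Or.inr ?_⟩ <;> omega

theorem edgeCount_S_odd {m : ℕ} (hm : 2 ≤ m) :
    edgeCount (S (2 * m + 1)) = 4 * (2 * m + 1) - 3 := by
  rw [edgeCount_S _ (fun u v => S_adj_odd) fun u v h => by
    rw [oddAdj_iff hm] at h; omega]
  obtain ⟨hfin, hcard⟩ := ncard_regularArcs (n := 2 * m) (f := fun j => 2 * j + 1)
    (g := fun j => if j % 2 = 0 then 2 * j - 1 else if j + 1 = 2 * m then 1 else 2 * j + 7)
    (fun j hj => by omega) (fun j hj => by split_ifs <;> omega)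
    (fun j hj => by split_ifs <;> omega)
  -- the one edge beyond two in-edges and two out-edges for each even vertex
  have hnot : ((4 * m, 5) : ℕ × ℕ) ∉ regularArcs (2 * m) (fun j => 2 * j + 1)
      (fun j => if j % 2 = 0 then 2 * j - 1 else if j + 1 = 2 * m then 1 else 2 * j + 7) := by
    rintro ⟨j, h1, h2, h⟩
    dsimp only at h
    split_ifs at h <;> omega
  rw [show 4 * (2 * m + 1) - 3 = 4 * (2 * m) + 1 by omega, ← hcard,
    ← Set.ncard_insert_of_notMem hnot hfin]
  congr 1
  ext ⟨u, v⟩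
  simp only [Set.mem_ofPred_eq, oddAdj_iff hm, regularArcs, Set.mem_insert_iff, Prod.mk.injEq]
  constructor
  · rintro ⟨h1, h2, h3, h4, h⟩
    by_cases h5 : u = 4 * m ∧ v = 5
    · exact Or.inl h5
    rcases h with ⟨hv, h⟩ | h
    · exact Or.inr ⟨v / 2, by omega, by omega, Or.inl (by omega)⟩
    · refine Or.inr ⟨u / 2, by omega, by omega, Or.inr ⟨by omega, ?_⟩⟩
      rcases h with ⟨hu, h | h⟩ | ⟨hu, hlt, h | h⟩ | ⟨hu, h | h⟩ | ⟨hu, h⟩ <;>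
        split_ifs <;> omega
  · rintro (⟨rfl, rfl⟩ | ⟨j, h1, h2, h⟩)
    · omega
    · rcases h with ⟨rfl, h⟩ | ⟨rfl, rfl | rfl⟩
      · exact ⟨by omega, by omega, by omega, by omega, Or.inl ⟨by omega, by omega⟩⟩
      · refine ⟨by omega, by omega, by omega, by omega, Or.inr ?_⟩
        omega
      · split_ifs <;> refine ⟨by omega, by omega, by omega, by omega, Or.inr ?_⟩ <;> omega

/-! ### Hamiltonian paths of `S_k` between paired vertices -/

/-- The relation `E` has a simple path from `u` to `v` whose vertices are exactly those satisfying
`P`. -/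
def IsSegment (E : ℕ → ℕ → Prop) (P : ℕ → Prop) (u v : ℕ) : Prop :=
  ∃ p : List ℕ, p.head? = some u ∧ p.getLast? = some v ∧ p.Nodup ∧ p.IsChain E ∧ ∀ x, x ∈ p ↔ P x

namespace IsSegment

variable {E : ℕ → ℕ → Prop} {P Q : ℕ → Prop} {u v w : ℕ}

theorem single (E : ℕ → ℕ → Prop) (u : ℕ) : IsSegment E (fun x => x = u) u u :=
  ⟨[u], by simp⟩

theorem congr (h : IsSegment E P u v) (hPQ : ∀ x, P x ↔ Q x) : IsSegment E Q u v := by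
  obtain ⟨p, h1, h2, h3, h4, h5⟩ := h
  exact ⟨p, h1, h2, h3, h4, fun x => (h5 x).trans (hPQ x)⟩

theorem snoc (h : IsSegment E P u v) (hvw : E v w) (hw : ¬ P w) :
    IsSegment E (fun x => P x ∨ x = w) u w := by
  obtain ⟨p, h1, h2, h3, h4, h5⟩ := h
  refine ⟨p ++ [w], ?_, by simp, ?_, ?_, by simp [h5]⟩
  · cases p <;> simp_all
  · rw [List.nodup_append']
    exact ⟨h3, by simp, by simpa [h5] using hw⟩
  · rw [List.isChain_append]
    refine ⟨h4, by simp, ?_⟩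
    intro x hx y hy
    rw [h2] at hx
    simp at hx hy
    subst hx hy
    exact hvw

/-- Extension of a segment along `v, v + 1, …, w`. -/
theorem ascend (h : IsSegment E P u v) (hvw : v ≤ w) (hE : ∀ x, v ≤ x → x < w → E x (x + 1))
    (hP : ∀ x, v < x → x ≤ w → ¬ P x) : IsSegment E (fun x => P x ∨ v < x ∧ x ≤ w) u w := by
  induction w, hvw using Nat.le_induction with
  | base => exact h.congr fun x => (or_iff_left (by omega)).symm
  | succ w hvw ih =>
    have := ih (fun x h1 h2 => hE x h1 (by omega)) fun x h1 h2 => hP x h1 (by omega)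
    refine (this.snoc (hE w hvw (by omega)) ?_).congr fun x => ?_
    · rintro (h | h)
      · exact hP _ (by omega) le_rfl h
      · omega
    · rw [or_assoc]
      exact or_congr_right (by omega)

theorem hasHamiltonianPath {k N : ℕ} (hN : 2 * k - 1 = N)
    (hE : ∀ a b : SVertex k, (S k).Adj a b ↔ E a b)
    {s o : SVertex k} (h : IsSegment E (fun x => 1 ≤ x ∧ x ≤ N) s o) :
    HasHamiltonianPath (S k) s o := by
  subst hN
  obtain ⟨p, h1, h2, h3, h4, h5⟩ := h
  lift p to List (SVertex k) using fun x hx => Finset.mem_Icc.2 ((h5 x).1 hx)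
  refine ⟨p, ⟨?_, ?_, h3.of_map, ?_⟩, ?_⟩
  · obtain ⟨a, ha, e⟩ := Option.map_eq_some_iff.1 (List.head?_map ▸ h1)
    rwa [← Subtype.ext e]
  · obtain ⟨a, ha, e⟩ := Option.map_eq_some_iff.1 (List.getLast?_map ▸ h2)
    rwa [← Subtype.ext e]
  · rw [List.isChain_map] at h4
    exact h4.imp fun a b hab => (hE a b).2 hab
  · intro w
    have := (h5 w).2 (Finset.mem_Icc.1 w.2)
    simpa using this

end IsSegment

/-- The edges that the graphs `S_k` for even and for odd `k` have in common: `m` blocks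
`4i - 2, 4i - 1, 4i, 4i + 1`, each an undirected path, preceded by `1`, and the directed edges
between consecutive blocks. -/
structure HasBlockArcs (m : ℕ) (E : ℕ → ℕ → Prop) : Prop where
  up : ∀ x, 1 ≤ x → x ≤ 4 * m → E x (x + 1)
  down : ∀ x, x % 4 ≠ 1 → 1 ≤ x → x ≤ 4 * m → E (x + 1) x
  jump : ∀ i, 1 ≤ i → i < m → E (4 * i - 2) (4 * i + 5)

theorem hasBlockArcs_even {m : ℕ} (hm : 1 ≤ m) : HasBlockArcs m (evenAdj (2 * m + 2)) := by
  refine ⟨fun x h1 h2 => ?_, fun x h1 h2 h3 => ?_, fun i h1 h2 => ?_⟩ <;> rw [evenAdj_iff hm] <;>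
    refine ⟨by omega, by omega, by omega, by omega, ?_⟩ <;> omega

theorem hasBlockArcs_odd {m : ℕ} (hm : 2 ≤ m) : HasBlockArcs m (oddAdj (2 * m + 1)) := by
  refine ⟨fun x h1 h2 => ?_, fun x h1 h2 h3 => ?_, fun i h1 h2 => ?_⟩ <;> rw [oddAdj_iff hm] <;>
    refine ⟨by omega, by omega, by omega, by omega, ?_⟩ <;> omega

namespace HasBlockArcs

variable {m : ℕ} {E : ℕ → ℕ → Prop} {P : ℕ → Prop} {u : ℕ}

/-- Extension of a segment that ends at the first vertex of a block through all vertices of the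
following blocks, each traversed downwards. -/
theorem descend (hE : HasBlockArcs m E) {t j : ℕ} (h : IsSegment E P u (4 * t - 2)) (ht : 1 ≤ t)
    (htj : t ≤ j) (hj : j ≤ m) (hP : ∀ x, 4 * t + 2 ≤ x → x ≤ 4 * j + 1 → ¬ P x) :
    IsSegment E (fun x => P x ∨ 4 * t + 2 ≤ x ∧ x ≤ 4 * j + 1) u (4 * j - 2) := by
  induction j, htj using Nat.le_induction with
  | base => exact h.congr fun x => (or_iff_left (by omega)).symm
  | succ j htj ih =>
    have h0 := ih (by omega) fun x h1 h2 => hP x h1 (by omega)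
    have hn : ∀ x, 4 * j + 2 ≤ x → x ≤ 4 * j + 5 → ¬ (P x ∨ 4 * t + 2 ≤ x ∧ x ≤ 4 * j + 1) :=
      fun x h1 h2 => not_or.2 ⟨hP x (by omega) (by omega), by omega⟩
    have h1 := h0.snoc (hE.jump j (by omega) (by omega)) (hn _ (by omega) (by omega))
    have h2 := h1.snoc (hE.down (4 * j + 4) (by omega) (by omega) (by omega))
      (not_or.2 ⟨hn _ (by omega) (by omega), by omega⟩)
    have h3 := h2.snoc (hE.down (4 * j + 3) (by omega) (by omega) (by omega))
      (not_or.2 ⟨not_or.2 ⟨hn _ (by omega) (by omega), by omega⟩, by omega⟩)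
    have h4 := h3.snoc (hE.down (4 * j + 2) (by omega) (by omega) (by omega))
      (not_or.2 ⟨not_or.2 ⟨not_or.2 ⟨hn _ (by omega) (by omega), by omega⟩, by omega⟩, by omega⟩)
    refine h4.congr fun x => ?_
    simp only [or_assoc]
    exact or_congr_right (by omega)

/-- The first part of the Hamiltonian paths that start at the last vertex of block `t`. -/
theorem segment_of_last (hE : HasBlockArcs m E) {t : ℕ} (ht : 1 ≤ t) (htm : t ≤ m) :
    IsSegment E (fun x => 4 * t - 2 ≤ x ∧ x ≤ 4 * m + 1) (4 * t + 1) (4 * m - 2) := by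
  have h0 := IsSegment.single E (4 * t + 1)
  have h1 := h0.snoc (hE.down (4 * t) (by omega) (by omega) (by omega)) (by omega)
  have h2 := h1.snoc (w := 4 * t - 1) (by
    have := hE.down (4 * t - 1) (by omega) (by omega) (by omega)
    rwa [show 4 * t - 1 + 1 = 4 * t by omega] at this) (by omega)
  have h3 := h2.snoc (w := 4 * t - 2) (by
    have := hE.down (4 * t - 2) (by omega) (by omega) (by omega)
    rwa [show 4 * t - 2 + 1 = 4 * t - 1 by omega] at this) (by omega)
  exact (hE.descend h3 ht htm le_rfl (by omega)).congr (by omega)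

/-- The first part of the Hamiltonian paths that start at the second vertex of block `g`. -/
theorem segment_of_second (hE : HasBlockArcs m E) {g : ℕ} (hg : 1 ≤ g) (hgm : g < m) :
    IsSegment E (fun x => 4 * g - 1 ≤ x ∧ x ≤ 4 * g + 2 ∨ 4 * g + 6 ≤ x ∧ x ≤ 4 * m + 1)
      (4 * g - 1) (4 * m - 2) := by
  have h0 := IsSegment.single E (4 * g - 1)
  have h1 := h0.ascend (w := 4 * (g + 1) - 2) (by omega)
    (fun x h1 h2 => hE.up x (by omega) (by omega)) (by omega)
  exact (hE.descend h1 (by omega) hgm le_rfl (by omega)).congr (by omega)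

/-- The last part of the Hamiltonian paths that end at the second vertex of block `g + 1`. -/
theorem to_second (hE : HasBlockArcs m E) {g : ℕ} (hg : 1 ≤ g) (hgm : g < m)
    (h : IsSegment E P u 1)
    (hP : ∀ x, 1 < x → x ≤ 4 * g - 2 ∨ 4 * g + 3 ≤ x ∧ x ≤ 4 * g + 5 → ¬ P x) :
    IsSegment E (fun x => P x ∨ 1 < x ∧ x ≤ 4 * g - 2 ∨ 4 * g + 3 ≤ x ∧ x ≤ 4 * g + 5) u
      (4 * (g + 1) - 1) := by
  have h1 := h.ascend (w := 4 * g - 2) (by omega)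
    (fun x h1 h2 => hE.up x (by omega) (by omega)) fun x h1 h2 => hP x h1 (Or.inl h2)
  have hn : ∀ x, 4 * g + 3 ≤ x → x ≤ 4 * g + 5 → ¬ (P x ∨ 1 < x ∧ x ≤ 4 * g - 2) :=
    fun x h1 h2 => not_or.2 ⟨hP x (by omega) (Or.inr ⟨h1, h2⟩), by omega⟩
  have h2 := h1.snoc (hE.jump g hg hgm) (hn _ (by omega) (by omega))
  have h3 := h2.snoc (hE.down (4 * g + 4) (by omega) (by omega) (by omega))
    (not_or.2 ⟨hn _ (by omega) (by omega), by omega⟩)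
  have h4 := h3.snoc (hE.down (4 * g + 3) (by omega) (by omega) (by omega))
    (not_or.2 ⟨not_or.2 ⟨hn _ (by omega) (by omega), by omega⟩, by omega⟩)
  refine h4.congr fun x => ?_
  simp only [or_assoc]
  exact or_congr_right (by omega)

end HasBlockArcs

/-- The number of the outgoing vertex paired with the incoming vertex `s` of `S_{2m+2}`: the second
vertex `4g - 1` of a block is paired with the second vertex of the next one, and the last vertex
`4g + 1` with the last vertex of the previous one, where `1` counts as the last vertex of block `0`
and `4m + 3` as the second vertex of block `m + 1`. -/
def evenPartner (m s : ℕ) : ℕ :=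
  if s = 1 then 3 else if s = 4 * m + 3 then 4 * m + 1 else if s % 4 = 3 then s + 4 else s - 4

/-- The number of the outgoing vertex paired with the incoming vertex `s` of `S_{2m+1}`. As for
even `k`, except at the ends: `1` is paired with the last vertex of block `m`, and the second vertex
of block `m` with that of block `1`. -/
def oddPartner (m s : ℕ) : ℕ :=
  if s = 1 then 4 * m + 1 else if s = 4 * m - 1 then 3 else if s % 4 = 3 then s + 4 else s - 4

theorem segment_even {m s : ℕ} (hm : 1 ≤ m) (hs : s % 2 = 1) (hs' : s ≤ 4 * m + 3) :
    IsSegment (evenAdj (2 * m + 2)) (fun x => 1 ≤ x ∧ x ≤ 4 * m + 3) s (evenPartner m s) := by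
  have hE := hasBlockArcs_even hm
  have e1 : evenAdj (2 * m + 2) (4 * m - 2) (4 * m + 3) := by rw [evenAdj_iff hm]; omega
  have e2 : evenAdj (2 * m + 2) (4 * m + 3) (4 * m + 2) := by rw [evenAdj_iff hm]; omega
  have e3 : evenAdj (2 * m + 2) (4 * m + 2) 1 := by rw [evenAdj_iff hm]; omega
  have e4 : evenAdj (2 * m + 2) (4 * m + 2) 5 := by rw [evenAdj_iff hm]; omega
  have e5 : evenAdj (2 * m + 2) (4 * m + 1) (4 * m + 2) := by rw [evenAdj_iff hm]; omega
  unfold evenPartner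
  split_ifs with h1 h2 h3
  · subst h1
    have p1 := (IsSegment.single _ 1).snoc (hE.up 1 (by omega) (by omega)) (by omega)
    have p2 := hE.descend (t := 1) p1 le_rfl hm le_rfl (by omega)
    have p3 := ((p2.snoc e1 (by omega)).snoc e2 (by omega)).snoc e4 (by omega)
    have p4 := p3.snoc (hE.down 4 (by omega) (by omega) (by omega)) (by omega)
    exact (p4.snoc (hE.down 3 (by omega) (by omega) (by omega)) (by omega)).congr (by omega)
  · subst h2
    have p1 := ((IsSegment.single _ (4 * m + 3)).snoc e2 (by omega)).snoc e3 (by omega)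
    exact (p1.ascend (w := 4 * m + 1) (by omega)
      (fun x h1 h2 => hE.up x (by omega) (by omega)) (by omega)).congr (by omega)
  · obtain ⟨g, rfl⟩ : ∃ g, s = 4 * g - 1 := ⟨(s + 1) / 4, by omega⟩
    by_cases hg : g = m
    · subst hg
      have p1 := (IsSegment.single (evenAdj (2 * g + 2)) (4 * g - 1)).ascend (w := 4 * g + 1)
        (by omega) (fun x h1 h2 => hE.up x (by omega) (by omega)) (by omega)
      have p2 := ((p1.snoc e5 (by omega)).snoc e3 (by omega)).ascend (w := 4 * g - 2) (by omega)
        (fun x h1 h2 => hE.up x (by omega) (by omega)) (by omega)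
      rw [show 4 * g - 1 + 4 = 4 * g + 3 by omega]
      exact (p2.snoc e1 (by omega)).congr (by omega)
    · have p1 := hE.segment_of_second (g := g) (by omega) (by omega)
      have p2 := ((p1.snoc e1 (by omega)).snoc e2 (by omega)).snoc e3 (by omega)
      rw [show 4 * g - 1 + 4 = 4 * (g + 1) - 1 by omega]
      exact (hE.to_second (g := g) (by omega) (by omega) p2 (by omega)).congr (by omega)
  · obtain ⟨t, rfl⟩ : ∃ t, s = 4 * t + 1 := ⟨s / 4, by omega⟩
    have p1 := hE.segment_of_last (t := t) (by omega) (by omega)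
    have p2 := ((p1.snoc e1 (by omega)).snoc e2 (by omega)).snoc e3 (by omega)
    exact (p2.ascend (w := 4 * t + 1 - 4) (by omega)
      (fun x h1 h2 => hE.up x (by omega) (by omega)) (by omega)).congr (by omega)

theorem segment_odd {m s : ℕ} (hm : 2 ≤ m) (hs : s % 2 = 1) (hs' : s ≤ 4 * m + 1) :
    IsSegment (oddAdj (2 * m + 1)) (fun x => 1 ≤ x ∧ x ≤ 4 * m + 1) s (oddPartner m s) := by
  have hE := hasBlockArcs_odd hm
  have e1 : oddAdj (2 * m + 1) (4 * m - 2) 1 := by rw [oddAdj_iff hm]; omega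
  have e2 : oddAdj (2 * m + 1) (4 * m) 5 := by rw [oddAdj_iff hm]; omega
  unfold oddPartner
  split_ifs with h1 h2 h3
  · subst h1
    exact ((IsSegment.single _ 1).ascend (w := 4 * m + 1) (by omega)
      (fun x h1 h2 => hE.up x (by omega) (by omega)) (by omega)).congr (by omega)
  · subst h2
    have p1 := (IsSegment.single _ (4 * m - 1)).snoc (w := 4 * m - 2) (by
      have := hE.down (4 * m - 2) (by omega) (by omega) (by omega)
      rwa [show 4 * m - 2 + 1 = 4 * m - 1 by omega] at this) (by omega)
    have p2 := (p1.snoc e1 (by omega)).snoc (hE.up 1 (by omega) (by omega)) (by omega)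
    have p3 := hE.descend (t := 1) (j := m - 1) p2 le_rfl (by omega) (by omega) (by omega)
    have p4 := p3.snoc (hE.jump (m - 1) (by omega) (by omega)) (by omega)
    rw [show 4 * (m - 1) + 5 = 4 * m + 1 by omega] at p4
    have p5 := (p4.snoc (hE.down (4 * m) (by omega) (by omega) (by omega)) (by omega)).snoc e2
      (by omega)
    have p6 := p5.snoc (hE.down 4 (by omega) (by omega) (by omega)) (by omega)
    exact (p6.snoc (hE.down 3 (by omega) (by omega) (by omega)) (by omega)).congr (by omega)
  · obtain ⟨g, rfl⟩ : ∃ g, s = 4 * g - 1 := ⟨(s + 1) / 4, by omega⟩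
    have p1 := hE.segment_of_second (g := g) (by omega) (by omega)
    rw [show 4 * g - 1 + 4 = 4 * (g + 1) - 1 by omega]
    exact (hE.to_second (g := g) (by omega) (by omega) (p1.snoc e1 (by omega)) (by omega)).congr
      (by omega)
  · obtain ⟨t, rfl⟩ : ∃ t, s = 4 * t + 1 := ⟨s / 4, by omega⟩
    have p1 := hE.segment_of_last (t := t) (by omega) (by omega)
    exact ((p1.snoc e1 (by omega)).ascend (w := 4 * t + 1 - 4) (by omega)
      (fun x h1 h2 => hE.up x (by omega) (by omega)) (by omega)).congr (by omega)

/-! ### No other Hamiltonian paths between the labelled vertices of `S_k` -/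

/-- `R a b` says that `b` comes right after `a` on a Hamiltonian path from `s` to `o` of the digraph
`E` on the vertices `1, …, N`. The laws listed are those needed to restrict `s` and `o`: besides the
degree conditions, there are no 2-cycles and the path has neither one nor three vertices. -/
structure IsHamStep (N : ℕ) (E : ℕ → ℕ → Prop) (s o : ℕ) (R : ℕ → ℕ → Prop) : Prop where
  adj : ∀ {a b}, R a b → E a b
  succ_unique : ∀ {a b c}, R a b → R a c → b = c
  pred_unique : ∀ {a b c}, R a c → R b c → a = b
  exists_succ : ∀ a, 1 ≤ a → a ≤ N → a ≠ o → ∃ b, R a b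
  exists_pred : ∀ a, 1 ≤ a → a ≤ N → a ≠ s → ∃ b, R b a
  not_start : ∀ {a}, ¬ R a s
  not_symm : ∀ {a b}, R a b → ¬ R b a
  not_short : ∀ {b}, R s b → ¬ R b o
  ne : s ≠ o

theorem HasHamiltonianPath.exists_isHamStep {k N : ℕ} (hk : 4 ≤ k) (hN : 2 * k - 1 = N)
    {E : ℕ → ℕ → Prop} (hE : ∀ a b : SVertex k, (S k).Adj a b ↔ E a b) {s o : SVertex k}
    (h : HasHamiltonianPath (S k) s o) : ∃ R, IsHamStep N E s o R := by
  subst hN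
  obtain ⟨π, hπ⟩ := h.exists_order
  have hf := hπ.finish
  have h0 := hπ.start
  rw [card_SVertex] at hf
  refine ⟨fun a b => ∃ u v : SVertex k, u = a ∧ v = b ∧ π v = π u + 1,
    ?_, ?_, ?_, ?_, ?_, ?_, ?_, ?_, ?_⟩
  · rintro _ _ ⟨u, v, rfl, rfl, h⟩
    exact (hE u v).1 (hπ.adj u v h)
  · rintro _ _ _ ⟨u, v, rfl, rfl, h⟩ ⟨u', v', hu, rfl, h'⟩
    obtain rfl := Subtype.ext hu
    rw [hπ.inj (h.trans h'.symm)]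
  · rintro _ _ _ ⟨u, v, rfl, rfl, h⟩ ⟨u', v', rfl, hv, h'⟩
    obtain rfl := Subtype.ext hv
    rw [hπ.inj (show π u = π u' by omega)]
  · intro a h1 h2 ha
    obtain ⟨x, hx, -⟩ := hπ.exists_succ (w := ⟨a, Finset.mem_Icc.2 ⟨h1, h2⟩⟩)
      (fun e => ha (congrArg Subtype.val e))
    exact ⟨x, _, _, rfl, rfl, hx⟩
  · intro a h1 h2 ha
    obtain ⟨x, hx, -⟩ := hπ.exists_pred (w := ⟨a, Finset.mem_Icc.2 ⟨h1, h2⟩⟩)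
      (fun e => ha (congrArg Subtype.val e))
    exact ⟨x, _, _, rfl, rfl, hx⟩
  · rintro _ ⟨u, v, rfl, hv, h⟩
    obtain rfl := Subtype.ext hv
    omega
  · rintro _ _ ⟨u, v, rfl, rfl, h⟩ ⟨v', u', hv, hu, h'⟩
    obtain rfl := Subtype.ext hv
    obtain rfl := Subtype.ext hu
    omega
  · rintro _ ⟨u, v, hu, rfl, h⟩ ⟨v', w, hv, hw, h'⟩
    obtain rfl := Subtype.ext hv
    obtain rfl := Subtype.ext hu
    obtain rfl := Subtype.ext hw
    omega
  · intro e
    obtain rfl := Subtype.ext e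
    omega

namespace IsHamStep

variable {n s o : ℕ} {E R : ℕ → ℕ → Prop}

/-- If the out-neighbours of odd vertices are next to them, a Hamiltonian path to `o` enters every
even vertex below `o` from the odd vertex below it: otherwise two odd vertices would have the same
successor. -/
theorem enter_below (h : IsHamStep (2 * n + 1) E s o R)
    (hE : ∀ a b, E a b → a % 2 = 1 → 1 ≤ b ∧ b ≤ 2 * n + 1 ∧ (a + 1 = b ∨ a = b + 1))
    (ho : o ≤ 2 * n + 1) (i : ℕ) (hi : 2 * i + 1 < o) : R (2 * i + 1) (2 * i + 2) := by
  induction i with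
  | zero =>
    obtain ⟨b, hb⟩ := h.exists_succ 1 le_rfl (by omega) (by omega)
    have := hE _ _ (h.adj hb) rfl
    obtain rfl : b = 2 := by omega
    exact hb
  | succ i ih =>
    obtain ⟨b, hb⟩ := h.exists_succ (2 * (i + 1) + 1) (by omega) (by omega) (by omega)
    rcases (hE _ _ (h.adj hb) (by omega)).2.2 with e | e
    · rwa [← e] at hb
    · obtain rfl : b = 2 * i + 2 := by omega
      have := h.pred_unique hb (ih (by omega))
      omega

theorem enter_above (h : IsHamStep (2 * n + 1) E s o R)
    (hE : ∀ a b, E a b → a % 2 = 1 → 1 ≤ b ∧ b ≤ 2 * n + 1 ∧ (a + 1 = b ∨ a = b + 1))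
    (i : ℕ) (hi : o + 2 * i < 2 * n + 1) (hin : i < n) :
    R (2 * n + 1 - 2 * i) (2 * n - 2 * i) := by
  induction i with
  | zero =>
    obtain ⟨b, hb⟩ := h.exists_succ (2 * n + 1) (by omega) (by omega) (by omega)
    have := hE _ _ (h.adj hb) (by omega)
    obtain rfl : b = 2 * n := by omega
    exact hb
  | succ i ih =>
    obtain ⟨b, hb⟩ := h.exists_succ (2 * n + 1 - 2 * (i + 1)) (by omega) (by omega) (by omega)
    rcases (hE _ _ (h.adj hb) (by omega)).2.2 with e | e
    · obtain rfl : b = 2 * n - 2 * i := by omega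
      have := h.pred_unique hb (ih (by omega) (by omega))
      omega
    · obtain rfl : b = 2 * n - 2 * (i + 1) := by omega
      exact hb

section Blocks

variable {N m s' : ℕ} (h : IsHamStep N E s o R)
  (hb : ∀ i, 1 ≤ i → i ≤ m → 4 * i - 1 ≠ s' → R (4 * i) (4 * i - 1) ∨ R (4 * i - 2) (4 * i - 1))
  (hd : ∀ i, 1 ≤ i → i < m → 4 * i + 5 ≠ s' →
    R (4 * i + 4) (4 * i + 5) ∨ R (4 * i - 2) (4 * i + 5))
include h hb hd

/-- The even-to-odd edges form a path through the odd vertices, in which the last vertex of each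
block comes before its second vertex. Even vertices in front of the start vertex must step back
along that path. -/
theorem leave_before (hbot : 3 ≤ s' → s' ≠ 5 → R 4 5) (i : ℕ) (hi : 1 ≤ i) (him : i ≤ m) :
    (4 * i - 1 ≤ s' → s' ≠ 4 * i + 1 → R (4 * i) (4 * i + 1)) ∧
      (4 * i + 3 ≤ s' → R (4 * i - 2) (4 * i - 1)) := by
  have hstep (j : ℕ) (hj : 1 ≤ j) (hjm : j ≤ m)
      (hc : 4 * j - 1 ≤ s' → s' ≠ 4 * j + 1 → R (4 * j) (4 * j + 1)) :
      4 * j + 3 ≤ s' → R (4 * j - 2) (4 * j - 1) := fun hs => by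
    rcases hb j hj hjm (by omega) with e | e
    · have := h.succ_unique e (hc (by omega) (by omega))
      omega
    · exact e
  induction i, hi using Nat.le_induction with
  | base => exact ⟨hbot, hstep 1 le_rfl him hbot⟩
  | succ i hi ih =>
    have hc : 4 * (i + 1) - 1 ≤ s' → s' ≠ 4 * (i + 1) + 1 →
        R (4 * (i + 1)) (4 * (i + 1) + 1) := fun h1 h2 => by
      rcases hd i hi (by omega) (by omega) with e | e
      · exact e
      · have := h.succ_unique e ((ih (by omega)).2 (by omega))
        omega
    exact ⟨hc, hstep _ (by omega) him hc⟩

/-- Even vertices behind the start vertex must step forward. -/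
theorem leave_after (htop : s' ≤ 4 * m + 1 → ¬ R (4 * m - 2) (4 * m - 1)) (i : ℕ) (hi : 1 ≤ i)
    (him : i ≤ m) :
    (s' ≤ 4 * i + 1 → ¬ R (4 * i - 2) (4 * i - 1)) ∧
      (s' < 4 * i - 1 ∨ s' = 4 * i + 1 → R (4 * i) (4 * i - 1)) := by
  have hstep (j : ℕ) (hj : 1 ≤ j) (hjm : j ≤ m)
      (ha : s' ≤ 4 * j + 1 → ¬ R (4 * j - 2) (4 * j - 1)) :
      s' < 4 * j - 1 ∨ s' = 4 * j + 1 → R (4 * j) (4 * j - 1) := fun hs =>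
    (hb j hj hjm (by omega)).resolve_right (ha (by omega))
  induction him using Nat.decreasingInduction with
  | self => exact ⟨htop, hstep m hi le_rfl htop⟩
  | of_succ i him ih =>
    have ha : s' ≤ 4 * i + 1 → ¬ R (4 * i - 2) (4 * i - 1) := fun hs e => by
      rcases hd i hi him (by omega) with e' | e'
      · have := h.succ_unique e' ((ih (by omega)).2 (by omega))
        omega
      · have := h.succ_unique e e'
        omega
    exact ⟨ha, hstep i hi (by omega) ha⟩

/-- The end `o` decides from which side the third vertex `4i` of a block is entered, and the start
decides to which side it is left; these must differ to avoid a 2-cycle. -/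
theorem four_mul_lt_iff (hbot : 3 ≤ s' → s' ≠ 5 → R 4 5)
    (htop : s' ≤ 4 * m + 1 → ¬ R (4 * m - 2) (4 * m - 1)) (ho : o % 2 = 1)
    (hlow : ∀ i, 1 ≤ i → i ≤ m → 4 * i < o → R (4 * i - 1) (4 * i))
    (hhigh : ∀ i, 1 ≤ i → i ≤ m → o < 4 * i → R (4 * i + 1) (4 * i)) (i : ℕ) (hi : 1 ≤ i)
    (him : i ≤ m) : 4 * i < o ↔ 4 * i - 1 ≤ s' ∧ s' ≠ 4 * i + 1 := by
  constructor
  · intro h1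
    by_contra h2
    exact h.not_symm (hlow i hi him h1) ((leave_after h hb hd htop i hi him).2 (by omega))
  · rintro ⟨h1, h2⟩
    by_contra h3
    exact h.not_symm (hhigh i hi him (by omega)) ((leave_before h hb hd hbot i hi him).1 h1 h2)

end Blocks

end IsHamStep

theorem eq_evenPartner {m s o : ℕ} {R : ℕ → ℕ → Prop} (hm : 1 ≤ m)
    (h : IsHamStep (4 * m + 3) (evenAdj (2 * m + 2)) s o R) (hs : s % 2 = 1)
    (hs' : s ≤ 4 * m + 3) (ho : o % 2 = 1) (ho' : o ≤ 4 * m + 3) : o = evenPartner m s := by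
  have hE : ∀ a b, R a b → _ := fun a b hab => (evenAdj_iff hm).1 (h.adj hab)
  have hN : 4 * m + 3 = 2 * (2 * m + 1) + 1 := by omega
  have hodd : ∀ a b, evenAdj (2 * m + 2) a b → a % 2 = 1 →
      1 ≤ b ∧ b ≤ 2 * (2 * m + 1) + 1 ∧ (a + 1 = b ∨ a = b + 1) := fun a b hab ha => by
    have := (evenAdj_iff hm).1 hab
    omega
  have h' := h
  rw [hN] at h'
  have hlow : ∀ i, 1 ≤ i → i ≤ m → 4 * i < o → R (4 * i - 1) (4 * i) := fun i h1 h2 h3 => by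
    have := h'.enter_below hodd (by omega) (2 * i - 1) (by omega)
    rwa [show 2 * (2 * i - 1) + 1 = 4 * i - 1 by omega,
      show 2 * (2 * i - 1) + 2 = 4 * i by omega] at this
  have hhigh : ∀ i, 1 ≤ i → i ≤ m → o < 4 * i → R (4 * i + 1) (4 * i) := fun i h1 h2 h3 => by
    have := h'.enter_above hodd (2 * m + 1 - 2 * i) (by omega) (by omega)
    rwa [show 2 * (2 * m + 1) + 1 - 2 * (2 * m + 1 - 2 * i) = 4 * i + 1 by omega,
      show 2 * (2 * m + 1) - 2 * (2 * m + 1 - 2 * i) = 4 * i by omega] at this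
  have hb : ∀ i, 1 ≤ i → i ≤ m → 4 * i - 1 ≠ s →
      R (4 * i) (4 * i - 1) ∨ R (4 * i - 2) (4 * i - 1) := fun i h1 h2 h3 => by
    obtain ⟨b, hb⟩ := h.exists_pred (4 * i - 1) (by omega) (by omega) h3
    have := hE _ _ hb
    rcases (by omega : b = 4 * i ∨ b = 4 * i - 2) with rfl | rfl
    exacts [Or.inl hb, Or.inr hb]
  have hd : ∀ i, 1 ≤ i → i < m → 4 * i + 5 ≠ s →
      R (4 * i + 4) (4 * i + 5) ∨ R (4 * i - 2) (4 * i + 5) := fun i h1 h2 h3 => by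
    obtain ⟨b, hb⟩ := h.exists_pred (4 * i + 5) (by omega) (by omega) h3
    have := hE _ _ hb
    rcases (by omega : b = 4 * i + 4 ∨ b = 4 * i - 2) with rfl | rfl
    exacts [Or.inl hb, Or.inr hb]
  have hbot : 3 ≤ s → s ≠ 5 → R 4 5 := fun h1 h2 => by
    obtain ⟨b, hb⟩ := h.exists_pred 1 (by omega) (by omega) (by omega)
    obtain ⟨c, hc⟩ := h.exists_pred 5 (by omega) (by omega) (by omega)
    have hb' := hE _ _ hb
    have hc' := hE _ _ hc
    obtain rfl : b = 4 * m + 2 := by omega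
    have hne : c ≠ 4 * m + 2 := by
      rintro rfl
      have := h.succ_unique hb hc
      omega
    obtain rfl : c = 4 := by omega
    exact hc
  have htop : s ≤ 4 * m + 1 → ¬ R (4 * m - 2) (4 * m - 1) := fun h1 e => by
    obtain ⟨b, hb⟩ := h.exists_pred (4 * m + 3) (by omega) (by omega) (by omega)
    have hb' := hE _ _ hb
    obtain rfl : b = 4 * m - 2 := by omega
    have := h.succ_unique hb e
    omega
  have key := h.four_mul_lt_iff hb hd hbot htop ho hlow hhigh
  have hne := h.ne
  unfold evenPartner
  split_ifs with h1 h2 h3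
  · have := key 1 le_rfl hm
    omega
  · have := key m hm le_rfl
    omega
  · obtain ⟨g, rfl⟩ : ∃ g, s = 4 * g - 1 := ⟨(s + 1) / 4, by omega⟩
    have k1 := key g (by omega) (by omega)
    have k2 := fun hgm => key (g + 1) (by omega) hgm
    have k3 : o ≠ 4 * g + 1 := by
      rintro rfl
      exact h.not_short (hlow g (by omega) (by omega) (by omega))
        ((h.leave_before hb hd hbot g (by omega) (by omega)).1 (by omega) (by omega))
    by_cases hgm : g + 1 ≤ m
    · have := k2 hgm
      omega
    · omega
  · obtain ⟨t, rfl⟩ : ∃ t, s = 4 * t + 1 := ⟨s / 4, by omega⟩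
    have k1 := key t (by omega) (by omega)
    have k2 := fun ht => key (t - 1) ht (by omega)
    have k3 : o ≠ 4 * t - 1 := by
      rintro rfl
      exact h.not_short (hhigh t (by omega) (by omega) (by omega))
        ((h.leave_after hb hd htop t (by omega) (by omega)).2 (by omega))
    by_cases ht : 1 ≤ t - 1
    · have := k2 ht
      omega
    · omega

/-- If the path uses the one edge of `S_{2m+1}` from the third vertex of block `m` to the last
vertex of block `1`, all other even vertices but `4m - 2` must step forward. -/
theorem leave_of_extra {m s o : ℕ} {R : ℕ → ℕ → Prop} (hm : 2 ≤ m)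
    (h : IsHamStep (4 * m + 1) (oddAdj (2 * m + 1)) s o R) (ho : o % 2 = 1)
    (hx : R (4 * m) 5) (i : ℕ) (hi : 1 ≤ i) (him : i < m) :
    R (4 * i) (4 * i - 1) ∧ R (4 * i - 2) (4 * i + 5) := by
  have hE : ∀ a b, R a b → _ := fun a b hab => (oddAdj_iff hm).1 (h.adj hab)
  have hstep (j : ℕ) (hj : 1 ≤ j) (hjm : j < m) (hc : R (4 * j) (4 * j - 1)) :
      R (4 * j - 2) (4 * j + 5) := by
    obtain ⟨b, hb⟩ := h.exists_succ (4 * j - 2) (by omega) (by omega) (by omega)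
    have := hE _ _ hb
    have hne : b ≠ 4 * j - 1 := by
      rintro rfl
      have := h.pred_unique hb hc
      omega
    obtain rfl : b = 4 * j + 5 := by omega
    exact hb
  induction i, hi using Nat.le_induction with
  | base =>
    obtain ⟨b, hb⟩ := h.exists_succ 4 (by omega) (by omega) (by omega)
    have := hE _ _ hb
    have hne : b ≠ 5 := by
      rintro rfl
      have := h.pred_unique hb hx
      omega
    obtain rfl : b = 3 := by omega
    exact ⟨hb, hstep 1 le_rfl him hb⟩
  | succ i hi ih =>
    obtain ⟨b, hb⟩ := h.exists_succ (4 * (i + 1)) (by omega) (by omega) (by omega)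
    have := hE _ _ hb
    have hne : b ≠ 4 * i + 5 := by
      rintro rfl
      have := h.pred_unique hb (ih (by omega)).2
      omega
    obtain rfl : b = 4 * (i + 1) - 1 := by omega
    exact ⟨hb, hstep _ (by omega) him hb⟩

theorem eq_oddPartner {m s o : ℕ} {R : ℕ → ℕ → Prop} (hm : 2 ≤ m)
    (h : IsHamStep (4 * m + 1) (oddAdj (2 * m + 1)) s o R) (hs : s % 2 = 1)
    (hs' : s ≤ 4 * m + 1) (ho : o % 2 = 1) (ho' : o ≤ 4 * m + 1) : o = oddPartner m s := by
  have hE : ∀ a b, R a b → _ := fun a b hab => (oddAdj_iff hm).1 (h.adj hab)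
  have hN : 4 * m + 1 = 2 * (2 * m) + 1 := by omega
  have hodd : ∀ a b, oddAdj (2 * m + 1) a b → a % 2 = 1 →
      1 ≤ b ∧ b ≤ 2 * (2 * m) + 1 ∧ (a + 1 = b ∨ a = b + 1) := fun a b hab ha => by
    have := (oddAdj_iff hm).1 hab
    omega
  have h' := h
  rw [hN] at h'
  have hlow : ∀ i, 1 ≤ i → i ≤ m → 4 * i < o → R (4 * i - 1) (4 * i) := fun i h1 h2 h3 => by
    have := h'.enter_below hodd (by omega) (2 * i - 1) (by omega)
    rwa [show 2 * (2 * i - 1) + 1 = 4 * i - 1 by omega,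
      show 2 * (2 * i - 1) + 2 = 4 * i by omega] at this
  have hhigh : ∀ i, 1 ≤ i → i ≤ m → o < 4 * i → R (4 * i + 1) (4 * i) := fun i h1 h2 h3 => by
    have := h'.enter_above hodd (2 * m - 2 * i) (by omega) (by omega)
    rwa [show 2 * (2 * m) + 1 - 2 * (2 * m - 2 * i) = 4 * i + 1 by omega,
      show 2 * (2 * m) - 2 * (2 * m - 2 * i) = 4 * i by omega] at this
  have hne := h.ne
  by_cases hx : R (4 * m) 5
  · have hfwd := leave_of_extra hm h ho hx
    -- otherwise `3` and `4` would form a 2-cycle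
    have ho3 : o ≤ 3 := by
      by_contra hlt
      exact h.not_symm (hlow 1 le_rfl (by omega) (by omega)) (hfwd 1 le_rfl (by omega)).1
    have hbm : R (4 * m - 1) (4 * m - 2) := by
      have := h'.enter_above hodd 1 (by omega) (by omega)
      rwa [show 2 * (2 * m) + 1 - 2 * 1 = 4 * m - 1 by omega,
        show 2 * (2 * m) - 2 * 1 = 4 * m - 2 by omega] at this
    have ham : R (4 * m - 2) 1 := by
      obtain ⟨b, hb⟩ := h.exists_succ (4 * m - 2) (by omega) (by omega) (by omega)
      have := hE _ _ hb
      have hne : b ≠ 4 * m - 1 := by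
        rintro rfl
        exact h.not_symm hb hbm
      obtain rfl : b = 1 := by omega
      exact hb
    -- every odd vertex other than `4m - 1` has a predecessor
    obtain rfl : s = 4 * m - 1 := by
      by_contra hsm
      rcases (by omega : s = 1 ∨ s = 5 ∨ s % 4 = 3 ∨ s % 4 = 1 ∧ 9 ≤ s) with h1 | h1 | h1 | h1
      · rw [← h1] at ham
        exact h.not_start ham
      · rw [← h1] at hx
        exact h.not_start hx
      · have := (hfwd ((s + 1) / 4) (by omega) (by omega)).1
        rw [show 4 * ((s + 1) / 4) - 1 = s by omega] at this
        exact h.not_start this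
      · have := (hfwd (s / 4 - 1) (by omega) (by omega)).2
        rw [show 4 * (s / 4 - 1) + 5 = s by omega] at this
        exact h.not_start this
    have ho1 : o ≠ 1 := by
      rintro rfl
      exact h.not_short hbm ham
    unfold oddPartner
    rw [if_neg (by omega), if_pos rfl]
    omega
  · -- the vertex `1` comes last in the order of the odd vertices, so it is renumbered `4m + 3`
    obtain ⟨s', hs1, hs2⟩ : ∃ s', (s = 1 → s' = 4 * m + 3) ∧ (s ≠ 1 → s' = s) :=
      ⟨if s = 1 then 4 * m + 3 else s, fun h => if_pos h, fun h => if_neg h⟩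
    have hb : ∀ i, 1 ≤ i → i ≤ m → 4 * i - 1 ≠ s' →
        R (4 * i) (4 * i - 1) ∨ R (4 * i - 2) (4 * i - 1) := fun i h1 h2 h3 => by
      obtain ⟨b, hb⟩ := h.exists_pred (4 * i - 1) (by omega) (by omega) (by omega)
      have := hE _ _ hb
      rcases (by omega : b = 4 * i ∨ b = 4 * i - 2) with rfl | rfl
      exacts [Or.inl hb, Or.inr hb]
    have hd : ∀ i, 1 ≤ i → i < m → 4 * i + 5 ≠ s' →
        R (4 * i + 4) (4 * i + 5) ∨ R (4 * i - 2) (4 * i + 5) := fun i h1 h2 h3 => by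
      obtain ⟨b, hb⟩ := h.exists_pred (4 * i + 5) (by omega) (by omega) (by omega)
      have := hE _ _ hb
      rcases (by omega : b = 4 * i + 4 ∨ b = 4 * i - 2) with rfl | rfl
      exacts [Or.inl hb, Or.inr hb]
    have hbot : 3 ≤ s' → s' ≠ 5 → R 4 5 := fun h1 h2 => by
      obtain ⟨c, hc⟩ := h.exists_pred 5 (by omega) (by omega) (by omega)
      have hc' := hE _ _ hc
      have hne : c ≠ 4 * m := by
        rintro rfl
        exact hx hc
      obtain rfl : c = 4 := by omega
      exact hc
    have htop : s' ≤ 4 * m + 1 → ¬ R (4 * m - 2) (4 * m - 1) := fun h1 e => by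
      obtain ⟨b, hb⟩ := h.exists_pred 1 (by omega) (by omega) (by omega)
      have hb' := hE _ _ hb
      obtain rfl : b = 4 * m - 2 := by omega
      have := h.succ_unique hb e
      omega
    have key := h.four_mul_lt_iff hb hd hbot htop ho hlow hhigh
    by_cases h1 : s = 1
    · have := key m (by omega) le_rfl
      rw [oddPartner, if_pos h1]
      omega
    obtain rfl := hs2 h1
    clear hs1 hs2
    rcases (by omega : s' % 4 = 3 ∨ s' % 4 = 1) with h3 | h3
    · obtain ⟨g, rfl⟩ : ∃ g, s' = 4 * g - 1 := ⟨(s' + 1) / 4, by omega⟩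
      have k1 := key g (by omega) (by omega)
      have k3 : o ≠ 4 * g + 1 := by
        rintro rfl
        exact h.not_short (hlow g (by omega) (by omega) (by omega))
          ((h.leave_before hb hd hbot g (by omega) (by omega)).1 (by omega) (by omega))
      by_cases hgm : g + 1 ≤ m
      · have k2 := key (g + 1) (by omega) hgm
        rw [oddPartner, if_neg h1, if_neg (by omega), if_pos h3]
        omega
      · omega
    · obtain ⟨t, rfl⟩ : ∃ t, s' = 4 * t + 1 := ⟨s' / 4, by omega⟩
      have k1 := key t (by omega) (by omega)
      have k3 : o ≠ 4 * t - 1 := by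
        rintro rfl
        exact h.not_short (hhigh t (by omega) (by omega) (by omega))
          ((h.leave_after hb hd htop t (by omega) (by omega)).2 (by omega))
      rw [oddPartner, if_neg h1, if_neg (by omega), if_neg (by omega)]
      by_cases ht : 1 ≤ t - 1
      · have k2 := key (t - 1) ht (by omega)
        omega
      · omega

/-! ### `S_k` is an in-out graph -/

theorem inVertex_injective (k : ℕ) : Function.Injective (inVertex k) := fun i j h => by
  have := congrArg Subtype.val h
  simp only [inVertex, inNum] at this
  omega

theorem outNum_even {m j s : ℕ} (hm : 1 ≤ m) (h1 : 1 ≤ j) (hj : j ≤ 2 * m + 2)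
    (hs : inNum j = s) : outNum (2 * m + 2) j = evenPartner m s := by
  rw [outNum, if_pos ⟨m + 1, by omega⟩, evenPartner]
  simp only [inNum] at hs
  simp only [Nat.even_iff]
  split_ifs <;> omega

theorem outNum_odd {m j s : ℕ} (hm : 2 ≤ m) (h1 : 1 ≤ j) (hj : j ≤ 2 * m + 1)
    (hs : inNum j = s) : outNum (2 * m + 1) j = oddPartner m s := by
  rw [outNum, if_neg (by rw [Nat.even_iff]; omega), oddPartner]
  simp only [inNum] at hs
  simp only [Nat.even_iff]
  split_ifs <;> omega

theorem evenPartner_injOn (m : ℕ) :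
    Set.InjOn (evenPartner m) {s | s % 2 = 1 ∧ s ≤ 4 * m + 3} := by
  rintro s ⟨hs, hs'⟩ t ⟨ht, ht'⟩ h
  unfold evenPartner at h
  split_ifs at h <;> omega

theorem oddPartner_injOn (m : ℕ) :
    Set.InjOn (oddPartner m) {s | s % 2 = 1 ∧ s ≤ 4 * m + 1} := by
  rintro s ⟨hs, hs'⟩ t ⟨ht, ht'⟩ h
  unfold oddPartner at h
  split_ifs at h <;> omega

theorem outVertex_injective (k : ℕ) (hk : 4 ≤ k) : Function.Injective (outVertex k hk) :=
    fun i j h => by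
  have h : outNum k (i + 1) = outNum k (j + 1) := congrArg Subtype.val h
  have hin : inNum (i + 1) = inNum (j + 1) := by
    rcases four_le_cases hk with ⟨m, hm, rfl⟩ | ⟨m, hm, rfl⟩
    · rw [outNum_even hm (by omega) (by omega) rfl, outNum_even hm (by omega) (by omega) rfl] at h
      exact evenPartner_injOn m ⟨by simp only [inNum]; omega, by simp only [inNum]; omega⟩
        ⟨by simp only [inNum]; omega, by simp only [inNum]; omega⟩ h
    · rw [outNum_odd hm (by omega) (by omega) rfl, outNum_odd hm (by omega) (by omega) rfl] at h
      exact oddPartner_injOn m ⟨by simp only [inNum]; omega, by simp only [inNum]; omega⟩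
        ⟨by simp only [inNum]; omega, by simp only [inNum]; omega⟩ h
  simp only [inNum] at hin
  omega

theorem S_pairedVertices (k : ℕ) (hk : 4 ≤ k) :
    PairedVertices (S k) (inVertex k) (outVertex k hk) := by
  have hodd : ∀ j, ((inVertex k j : ℕ)) % 2 = 1 := fun j => by simp only [inVertex, inNum]; omega
  have hodd' : ∀ j, ((outVertex k hk j : ℕ)) % 2 = 1 := fun j =>
    Nat.odd_iff.1 ((S_isInOutBipartition k hk).2.2.2 j)
  have hle : ∀ v : SVertex k, (v : ℕ) ≤ 2 * k - 1 := fun v => (Finset.mem_Icc.1 v.2).2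
  intro j n
  constructor
  · intro h
    refine outVertex_injective k hk (Subtype.ext (Eq.symm ?_))
    rcases four_le_cases hk with ⟨m, hm, rfl⟩ | ⟨m, hm, rfl⟩
    · have hN : 2 * (2 * m + 2) - 1 = 4 * m + 3 := by omega
      obtain ⟨R, hR⟩ := h.exists_isHamStep hk hN fun _ _ => S_adj_even
      rw [eq_evenPartner hm hR (hodd j) ((hle _).trans_eq hN) (hodd' n) ((hle _).trans_eq hN)]
      exact (outNum_even hm (by omega) (by omega) rfl).symm
    · have hN : 2 * (2 * m + 1) - 1 = 4 * m + 1 := by omega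
      obtain ⟨R, hR⟩ := h.exists_isHamStep hk hN fun _ _ => S_adj_odd
      rw [eq_oddPartner hm hR (hodd j) ((hle _).trans_eq hN) (hodd' n) ((hle _).trans_eq hN)]
      exact (outNum_odd hm (by omega) (by omega) rfl).symm
  · rintro rfl
    rcases four_le_cases hk with ⟨m, hm, rfl⟩ | ⟨m, hm, rfl⟩
    · have hN : 2 * (2 * m + 2) - 1 = 4 * m + 3 := by omega
      refine IsSegment.hasHamiltonianPath hN (fun _ _ => S_adj_even) ?_
      have := segment_even hm (hodd j) ((hle _).trans_eq hN)
      rwa [show evenPartner m (inVertex (2 * m + 2) j) = outVertex (2 * m + 2) hk j from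
        (outNum_even hm (by omega) (by omega) rfl).symm] at this
    · have hN : 2 * (2 * m + 1) - 1 = 4 * m + 1 := by omega
      refine IsSegment.hasHamiltonianPath hN (fun _ _ => S_adj_odd) ?_
      have := segment_odd hm (hodd j) ((hle _).trans_eq hN)
      rwa [show oddPartner m (inVertex (2 * m + 1) j) = outVertex (2 * m + 1) hk j from
        (outNum_odd hm (by omega) (by omega) rfl).symm] at this

theorem S_isInOutGraph (k : ℕ) (hk : 4 ≤ k) :
    IsInOutGraph (S k) (inVertex k) (outVertex k hk) :=
  ⟨inVertex_injective k, outVertex_injective k hk, S_pairedVertices k hk,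
    singleVisit_of_isInOutBipartition (S_isInOutBipartition k hk)⟩

end InOut

theorem mainTheorem3 (k : ℕ) (hk : 4 ≤ k) :
    -- `S_k` is a `k`-in-out graph of order `2k - 1`
    InOut.IsInOutGraph (InOut.S k) (InOut.inVertex k) (InOut.outVertex k hk) ∧
    Nat.card (InOut.SVertex k) = 2 * k - 1 ∧
    -- this order is minimal among all `k`-in-out graphs
    (∀ (V : Type*) [Finite V] (G : Digraph V) (inc out : Fin k → V),
      InOut.IsInOutGraph G inc out → 2 * k - 1 ≤ Nat.card V) ∧
    -- `S_k` is bipartite, with parts of sizes `k` and `k - 1`, the larger one containing all labels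
    InOut.IsInOutBipartition (InOut.S k) (InOut.inVertex k) (InOut.outVertex k hk)
      (InOut.oddPart k) ∧
    (InOut.oddPart k).ncard = k ∧ (InOut.oddPart k)ᶜ.ncard = k - 1 ∧
    -- any such bipartition of any graph forces the single visit condition
    (∀ (V : Type*) [Finite V] (G : Digraph V) (n : ℕ) (inc out : Fin n → V) (A : Set V),
      InOut.IsInOutBipartition G inc out A → InOut.SingleVisit G inc out) ∧
    -- the numbers of edges
    (Even k → InOut.edgeCount (InOut.S k) = 4 * k - 4) ∧
    (Odd k → InOut.edgeCount (InOut.S k) = 4 * k - 3) ∧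
    -- every `k`-in-out graph of order `2k - 1` has at least `4k - 4` edges
    (∀ (V : Type*) [Finite V] (G : Digraph V) (inc out : Fin k → V),
      InOut.IsInOutGraph G inc out → Nat.card V = 2 * k - 1 →
        4 * k - 4 ≤ InOut.edgeCount G) := by
  refine ⟨InOut.S_isInOutGraph k hk, InOut.card_SVertex k, ?_, InOut.S_isInOutBipartition k hk,
    InOut.ncard_oddPart (by omega), InOut.ncard_compl_oddPart (by omega), ?_, ?_, ?_, ?_⟩
  · intro V _ G inc out h
    exact h.two_mul_sub_one_le_card (by omega)
  · intro V _ G n inc out A h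
    exact InOut.singleVisit_of_isInOutBipartition h
  · intro he
    obtain ⟨m, hm, rfl⟩ | ⟨m, hm, rfl⟩ := InOut.four_le_cases hk
    · exact InOut.edgeCount_S_even hm
    · exact absurd he (by simp)
  · intro ho
    obtain ⟨m, hm, rfl⟩ | ⟨m, hm, rfl⟩ := InOut.four_le_cases hk
    · exact absurd ho (by rw [Nat.odd_iff]; omega)
    · exact InOut.edgeCount_S_odd hm
  · intro V _ G inc out h hV
    exact h.four_mul_sub_four_le_edgeCount (by omega) hV
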